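/- Let $b\in(0,1)$, $c\in\mathbb C$, $a_R\in\mathbb C$ with $\operatorname{Re}a_R>0$, and let $a=1$ on $(0,b)$ and $a=a_R$ on $(b,1)$. Consider the transmission eigenvalue problem $$-(au')'=\lambda u\ \text{ in }(0,1)\setminus\{b\},\qquad u(0)=0,\quad a_Ru'(1)+cu(1)=0,\quad [u]_b=[au']_b=0 ,$$ where $[\cdot]_b$ is the jump at $b$, in its weak form: let $V=\{v\in H^1(0,1): v(0)=0\}$ (complex-valued functions), let $(\cdot,\cdot)$ be the $L^2(0,1)$ scalar product, extended to the pairing of $V$ with the space $V^\times$ of antilinear functionals on $V$, let $A(u,v)=(au',v')+c\,u(1)\overline{v(1)}$, and let $\mathcal A:V\to V^\times$ be given by $(\mathcal Au,v)=A(u,v)$. An eigenpair is $(u,\lambda)\in (V\setminus\{0\})\times\mathbb C$ with $A(u,v)=\lambda(u,v)$ for all $v\in V$. Regard $\mathcal A-\lambda I$ as an operator in $V^\times\supset V$ with domain $V$; thus $\mathcal N((\mathcal A-\lambda I)^0)=\{0\}$, and $w\in V$ lies in $\mathcal N((\mathcal A-\lambda I)^{k+1})$ iff $(\mathcal A-\lambda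 I)w\in\mathcal N((\mathcal A-\lambda I)^{k})$. The ascent $\alpha$ of $\lambda$ is the smallest $k$ with $\mathcal N((\mathcal A-\lambda I)^k)=\mathcal N((\mathcal A-\lambda I)^{k+1})$; the generalized eigenspace is $\mathcal N((\mathcal A-\lambda I)^{\alpha})$ and its dimension is the algebraic multiplicity. Let $(u_j,\lambda_j)$ be an eigenpair with $\lambda_j\ne0$. For $\lambda$ near $\lambda_j$ let $\mu_L=\sqrt{\lambda}$ and $\mu_R=\sqrt{\lambda/a_R}$, with any holomorphic branches near $\lambda_j$, and put $$v^L(\lambda,x)=\sin\mu_Lx,\qquad v^R(\lambda,x)=(a_R\mu_R\sin\mu_R-c\cos\mu_R)\sin\mu_Rx+(a_R\mu_R\cos\mu_R+c\sin\mu_R)\cos\mu_Rx ,$$ so that $a_R\partial_xv^R(\lambda,1)+cv^R(\lambda,1)=0$, and $$\mathbf M_{a,b,c}(\lambda)=\begin{pmatrix}v^L(\lambda,b)&-v^R(\lambda,b)\\ \partial_xv^L(\lambda,b)&-a_R\partial_xv^R(\lambda,b)\end{pmatrix},\qquad \det\mathbf M_{a,b,c}(\lambda)=\sum_{\ell\ge0}\gamma_\ell(\lambda-\lambda_j)^\ell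 .$$ Assume that $\det\mathbf M_{a,b,c}$ does not vanish identically near $\lambda_j$, and let $\nu$ be the order of its zero at $\lambda_j$: $\gamma_\ell=0$ for $0\le\ell<\nu$ and $\gamma_\nu\neq0$. Then: 1. The ascent of $\lambda_j$ equals $\nu$, and so does its algebraic multiplicity. Moreover, for $\Lambda\in\mathbb R$ and any linear $K_\Lambda:V\to V$ with $A(K_\Lambda u,v)+\Lambda(K_\Lambda u,v)=(u,v)$ for all $u,v\in V$, one has $\lambda_j+\Lambda\ne0$ and, with $\mu=1/(\lambda_j+\Lambda)$, the null spaces $\mathcal N((K_\Lambda-\mu I)^k)$ and $\mathcal N((\mathcal A-\lambda_jI)^k)$ coincide for all $k\ge0$; in particular $K_\Lambda-\mu I$ has ascent $\nu$. 2. For $\lambda$ near $\lambda_j$ and $\mathbf A(\lambda)=(A_1(\lambda),A_2(\lambda))$ analytic at $\lambda_j$, let $u_j(\lambda,x)=A_1(\lambda)v^L(\lambda,x)$ for $x\le b$ and $u_j(\lambda,x)=A_2(\lambda)v^R(\lambda,x)$ for $x>b$. There is an $\mathbf A$ with $u_j(\lambda_j,\cdot)=u_j$ which, for some row index $i$ for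 which the $i$-th row of $\mathbf M_{a,b,c}(\lambda_j)$ is not zero, satisfies the transmission equation $(\mathbf M_{a,b,c}(\lambda)\mathbf A(\lambda))_i=0$ for all $\lambda$ near $\lambda_j$. Every such $\mathbf A$ satisfies $$\mathbf M_{a,b,c}(\lambda)\mathbf A(\lambda)=O\big((\lambda-\lambda_j)^\nu\big)\quad(\lambda\to\lambda_j).\tag{$*$}$$ 3. For every $\mathbf A$ analytic at $\lambda_j$ with $u_j(\lambda_j,\cdot)=u_j$ and $(*)$, the functions $$w_\ell=\frac{d^{\ell-1}u_j}{d\lambda^{\ell-1}}\Big|_{\lambda=\lambda_j},\qquad 1\le\ell\le\nu,$$ belong to $V$ and span the generalized eigenspace of $\lambda_j$, and $w_\ell\in\mathcal N((\mathcal A-\lambda_jI)^\ell)$ but $w_\ell\notin\mathcal N((\mathcal A-\lambda_jI)^\kappa)$ for $0\le\kappa<\ell$. -/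

import Mathlib

open MeasureTheory Set Filter Topology
open scoped ContDiff ComplexConjugate

namespace Transmission

noncomputable section

/-- Lebesgue measure on the interval `Ω = (0,1)`. -/
def mu : Measure ℝ := volume.restrict (Ioo (0 : ℝ) 1)

/-- The space `L²(0,1)` of complex-valued functions. -/
abbrev L2 : Type := Lp ℂ 2 mu

/-- A continuous function on `[0,1]`, extended to `ℝ` by constants; only the values on `[0,1]`
are ever used. -/
def extR (u : C(unitInterval, ℂ)) : ℝ → ℂ := IccExtend (zero_le_one' ℝ) u

/-- `g` is the weak derivative of `u` on `(0,1)`. -/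
def HasWeakDeriv (u g : ℝ → ℂ) : Prop :=
  ∀ φ : ℝ → ℝ, ContDiff ℝ ∞ φ → HasCompactSupport φ → tsupport φ ⊆ Ioo (0 : ℝ) 1 →
    ∫ x, deriv φ x • u x ∂mu = - ∫ x, φ x • g x ∂mu

instance : IsFiniteMeasure mu := by unfold mu; infer_instance

lemma integrable_L2 (g : L2) : Integrable g mu :=
  (Lp.memLp g).integrable (by norm_num)

lemma integrable_smul_of_bdd {φ : ℝ → ℝ} (hφ : Continuous φ) (hc : HasCompactSupport φ)
    {g : ℝ → ℂ} (hg : Integrable g mu) : Integrable (fun x => φ x • g x) mu := by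
  obtain ⟨C, hC⟩ := hc.exists_bound_of_continuous hφ
  exact hg.bdd_smul C hφ.aestronglyMeasurable (Eventually.of_forall hC)

lemma continuous_ext (u : C(unitInterval, ℂ)) : Continuous (extR u) :=
  u.continuous.Icc_extend'

lemma norm_ext_le (u : C(unitInterval, ℂ)) (x : ℝ) : ‖extR u x‖ ≤ ‖u‖ :=
  u.norm_coe_le_norm _

lemma memLp_ext (u : C(unitInterval, ℂ)) : MemLp (extR u) 2 mu :=
  MemLp.of_bound (continuous_ext u).aestronglyMeasurable ‖u‖
    (Eventually.of_forall (norm_ext_le u))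

lemma integrable_ext (u : C(unitInterval, ℂ)) : Integrable (extR u) mu :=
  (memLp_ext u).integrable (by norm_num)

lemma HasWeakDeriv.add {u v : C(unitInterval, ℂ)} {f g : L2} (hu : HasWeakDeriv (extR u) f)
    (hv : HasWeakDeriv (extR v) g) : HasWeakDeriv (extR (u + v)) (f + g : L2) := by
  intro φ h1 h2 h3
  have hd : Continuous (deriv φ) := h1.continuous_deriv (by simp)
  have hcd : HasCompactSupport (deriv φ) := h2.deriv
  have e1 : ∫ x, deriv φ x • extR (u + v) x ∂mu
      = ∫ x, deriv φ x • extR u x ∂mu + ∫ x, deriv φ x • extR v x ∂mu := by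
    rw [← integral_add (integrable_smul_of_bdd hd hcd (integrable_ext u))
      (integrable_smul_of_bdd hd hcd (integrable_ext v))]
    refine integral_congr_ae (Eventually.of_forall fun x => ?_)
    simp [extR, IccExtend]
  have e2 : ∫ x, φ x • (f + g : L2) x ∂mu
      = ∫ x, φ x • f x ∂mu + ∫ x, φ x • g x ∂mu := by
    rw [← integral_add (integrable_smul_of_bdd h1.continuous h2 (integrable_L2 f))
      (integrable_smul_of_bdd h1.continuous h2 (integrable_L2 g))]
    refine integral_congr_ae ?_
    filter_upwards [Lp.coeFn_add f g] with x hx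
    rw [hx, Pi.add_apply, smul_add]
  rw [e1, e2, hu φ h1 h2 h3, hv φ h1 h2 h3]
  ring

lemma HasWeakDeriv.smul (k : ℂ) {u : C(unitInterval, ℂ)} {f : L2}
    (hu : HasWeakDeriv (extR u) f) : HasWeakDeriv (extR (k • u)) (k • f : L2) := by
  intro φ h1 h2 h3
  have e1 : ∫ x, deriv φ x • extR (k • u) x ∂mu = k * ∫ x, deriv φ x • extR u x ∂mu := by
    rw [← integral_const_mul]
    refine integral_congr_ae (Eventually.of_forall fun x => ?_)
    simp [extR, IccExtend, mul_left_comm]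
  have e2 : ∫ x, φ x • (k • f : L2) x ∂mu = k * ∫ x, φ x • f x ∂mu := by
    rw [← integral_const_mul]
    refine integral_congr_ae ?_
    filter_upwards [Lp.coeFn_smul k f] with x hx
    rw [hx, Pi.smul_apply, smul_comm, smul_eq_mul]
  rw [e1, e2, hu φ h1 h2 h3]
  ring

lemma HasWeakDeriv.unique {u : ℝ → ℂ} {f g : L2} (hf : HasWeakDeriv u f)
    (hg : HasWeakDeriv u g) : f = g := by
  have hint : Integrable (fun x => f x - g x) mu := (integrable_L2 f).sub (integrable_L2 g)
  have key : ∀ᵐ x ∂(volume : Measure ℝ), x ∈ Ioo (0 : ℝ) 1 → f x - g x = 0 := by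
    refine isOpen_Ioo.ae_eq_zero_of_integral_contDiff_smul_eq_zero
      (IntegrableOn.locallyIntegrableOn hint) ?_
    intro φ h1 h2 h3
    have e : ∫ x, φ x • (f x - g x) ∂mu = 0 := by
      simp only [smul_sub]
      rw [integral_sub (integrable_smul_of_bdd h1.continuous h2 (integrable_L2 f))
        (integrable_smul_of_bdd h1.continuous h2 (integrable_L2 g))]
      have := (hf φ h1 h2 h3).symm.trans (hg φ h1 h2 h3)
      rw [neg_inj.mp this, sub_self]
    rw [← e]
    refine (setIntegral_eq_integral_of_forall_compl_eq_zero ?_).symm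
    intro x hx
    have : φ x = 0 := by
      by_contra h
      exact hx (h3 (subset_tsupport φ h))
    simp [this]
  refine Lp.ext ?_
  have := (ae_restrict_iff' measurableSet_Ioo).2 key
  filter_upwards [this] with x hx
  exact sub_eq_zero.mp hx

/-- The space `V = {v ∈ H¹(0,1) | v(0) = 0}`. An element of `H¹(0,1)` is represented by its
continuous version on `[0,1]`, so that traces are values. (The usual vector space structure of
`C([0,1], ℂ)` is spelled out in the type, to ease instance search.) -/
def V : @Submodule ℂ C(unitInterval, ℂ) _ AddCommGroup.toAddCommMonoid NormedSpace.toModule where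
  carrier := {u | (∃ g : L2, HasWeakDeriv (extR u) g) ∧ u 0 = 0}
  add_mem' := by
    rintro u v ⟨⟨f, hf⟩, hu⟩ ⟨⟨g, hg⟩, hv⟩
    exact ⟨⟨f + g, hf.add hg⟩, by simp [hu, hv]⟩
  zero_mem' := by
    refine ⟨⟨0, ?_⟩, rfl⟩
    intro φ _ _ _
    have e : ∫ x, φ x • (0 : L2) x ∂mu = 0 := by
      refine integral_eq_zero_of_ae ?_
      filter_upwards [Lp.coeFn_zero ℂ 2 mu] with x hx
      rw [hx, Pi.zero_apply, smul_zero]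
    rw [e]
    simp [extR, IccExtend]
  smul_mem' := by
    rintro k u ⟨⟨f, hf⟩, hu⟩
    exact ⟨⟨k • f, hf.smul k⟩, by simp [hu]⟩

/-- The weak derivative `u ↦ u'`, as a linear map `V → L²(0,1)`. -/
def D : V →ₗ[ℂ] L2 where
  toFun u := Classical.choose u.2.1
  map_add' u v := (Classical.choose_spec (u + v).2.1).unique
    ((Classical.choose_spec u.2.1).add (Classical.choose_spec v.2.1))
  map_smul' k u := (Classical.choose_spec (k • u).2.1).unique
    ((Classical.choose_spec u.2.1).smul k)

lemma hasWeakDeriv_D (u : V) : HasWeakDeriv (extR u.1) (D u) :=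
  Classical.choose_spec u.2.1

/-- The coefficient `a`, equal to `1` on `(0,b)` and to `aR` on `(b,1)`. -/
def coeff (aR : ℂ) (b : ℝ) (x : ℝ) : ℂ := if x < b then 1 else aR

lemma integrable_mul_conj {f g : ℝ → ℂ} (hf : MemLp f 2 mu) (hg : MemLp g 2 mu) :
    Integrable (fun x => f x * conj (g x)) mu :=
  hf.integrable_mul hg.star

lemma integrable_form (aR : ℂ) (b : ℝ) (f g : L2) :
    Integrable (fun x => coeff aR b x * f x * conj (g x)) mu := by
  have hm : Measurable (coeff aR b) :=
    Measurable.ite measurableSet_Iio measurable_const measurable_const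
  have := (integrable_mul_conj (Lp.memLp f) (Lp.memLp g)).bdd_mul (c := max 1 ‖aR‖)
    hm.aestronglyMeasurable (Eventually.of_forall fun x => by
      unfold coeff
      split_ifs <;> simp)
  simpa only [mul_assoc] using this

/-- The space `V^×` of antilinear functionals on `V`. -/
abbrev Vdual : Type := V →ₛₗ[starRingEnd ℂ] ℂ

/-- The operator `𝒜 : V → V^×` of the sesquilinear form
`A(u,v) = (a u', v') + c u(1) conj (v(1))`. -/
def opA (aR : ℂ) (b : ℝ) (c : ℂ) : V →ₗ[ℂ] Vdual :=
  LinearMap.mk₂'ₛₗ (RingHom.id ℂ) (starRingEnd ℂ)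
    (fun u v => ∫ x, coeff aR b x * D u x * conj (D v x) ∂mu + c * u.1 1 * conj (v.1 1))
    (by
      intro u₁ u₂ v
      have : ∫ x, coeff aR b x * D (u₁ + u₂) x * conj (D v x) ∂mu
          = ∫ x, coeff aR b x * D u₁ x * conj (D v x) ∂mu
            + ∫ x, coeff aR b x * D u₂ x * conj (D v x) ∂mu := by
        rw [← integral_add (integrable_form aR b (D u₁) (D v))
          (integrable_form aR b (D u₂) (D v)), map_add]
        refine integral_congr_ae ?_
        filter_upwards [Lp.coeFn_add (D u₁) (D u₂)] with x hx
        simp only [hx, Pi.add_apply]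
        ring
      rw [this]
      simp only [Submodule.coe_add, ContinuousMap.add_apply]
      ring)
    (by
      intro k u v
      have : ∫ x, coeff aR b x * D (k • u) x * conj (D v x) ∂mu
          = k * ∫ x, coeff aR b x * D u x * conj (D v x) ∂mu := by
        rw [← integral_const_mul, map_smul]
        refine integral_congr_ae ?_
        filter_upwards [Lp.coeFn_smul k (D u)] with x hx
        simp only [hx, Pi.smul_apply, smul_eq_mul]
        ring
      rw [this]
      simp only [Submodule.coe_smul, ContinuousMap.smul_apply, smul_eq_mul, RingHom.id_apply]
      ring)
    (by
      intro u v₁ v₂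
      have : ∫ x, coeff aR b x * D u x * conj (D (v₁ + v₂) x) ∂mu
          = ∫ x, coeff aR b x * D u x * conj (D v₁ x) ∂mu
            + ∫ x, coeff aR b x * D u x * conj (D v₂ x) ∂mu := by
        rw [← integral_add (integrable_form aR b (D u) (D v₁))
          (integrable_form aR b (D u) (D v₂)), map_add]
        refine integral_congr_ae ?_
        filter_upwards [Lp.coeFn_add (D v₁) (D v₂)] with x hx
        simp only [hx, Pi.add_apply, map_add]
        ring
      rw [this]
      simp only [Submodule.coe_add, ContinuousMap.add_apply, map_add]
      ring)
    (by
      intro k u v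
      have : ∫ x, coeff aR b x * D u x * conj (D (k • v) x) ∂mu
          = conj k * ∫ x, coeff aR b x * D u x * conj (D v x) ∂mu := by
        rw [← integral_const_mul, map_smul]
        refine integral_congr_ae ?_
        filter_upwards [Lp.coeFn_smul k (D v)] with x hx
        simp only [hx, Pi.smul_apply, smul_eq_mul, map_mul]
        ring
      rw [this]
      simp only [Submodule.coe_smul, ContinuousMap.smul_apply, smul_eq_mul, map_mul]
      ring)

/-- The embedding `I : V → V^×` given by the `L²` scalar product `(u,v) = ∫ u conj v`. -/
def opI : V →ₗ[ℂ] Vdual :=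
  LinearMap.mk₂'ₛₗ (RingHom.id ℂ) (starRingEnd ℂ)
    (fun u v => ∫ x, extR u.1 x * conj (extR v.1 x) ∂mu)
    (by
      intro u₁ u₂ v
      rw [← integral_add (integrable_mul_conj (memLp_ext u₁.1) (memLp_ext v.1))
        (integrable_mul_conj (memLp_ext u₂.1) (memLp_ext v.1))]
      refine integral_congr_ae (Eventually.of_forall fun x => ?_)
      simp [extR, IccExtend, add_mul])
    (by
      intro k u v
      rw [smul_eq_mul, ← integral_const_mul]
      refine integral_congr_ae (Eventually.of_forall fun x => ?_)
      simp [extR, IccExtend, mul_assoc])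
    (by
      intro u v₁ v₂
      rw [← integral_add (integrable_mul_conj (memLp_ext u.1) (memLp_ext v₁.1))
        (integrable_mul_conj (memLp_ext u.1) (memLp_ext v₂.1))]
      refine integral_congr_ae (Eventually.of_forall fun x => ?_)
      simp [extR, IccExtend, mul_add])
    (by
      intro k u v
      rw [smul_eq_mul, ← integral_const_mul]
      refine integral_congr_ae (Eventually.of_forall fun x => ?_)
      simp [extR, IccExtend, mul_left_comm])

/-- The null space `N((𝒜 - λI)^k) ⊆ V`. Here `𝒜 - λI` is regarded as an operator in `V^×` with
domain `V`, where `V` is a subspace of `V^×` through `I`; thus `w` lies in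
`N((𝒜 - λI)^(k+1))` iff `(𝒜 - λI) w` is (the image under `I` of) an element of
`N((𝒜 - λI)^k)`. -/
def nullSpace (aR : ℂ) (b : ℝ) (c lam : ℂ) : ℕ → Submodule ℂ V
  | 0 => ⊥
  | k + 1 => ((nullSpace aR b c lam k).map opI).comap (opA aR b c - lam • opI)

/-- `K` is the solution operator `K_Λ : V → V` of the shifted form `A + Λ (·,·)`, that is,
`A(K u, v) + Λ (K u, v) = (u, v)` for all `u, v ∈ V`. -/
def IsSolutionOperator (aR : ℂ) (b : ℝ) (c : ℂ) (Lam : ℝ) (K : Module.End ℂ V) : Prop :=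
  ∀ u v : V, opA aR b c (K u) v + Lam * opI (K u) v = opI u v

/-- The null space `N((K - μ I)^k)` of an operator `K : V → V`. -/
def kerPow (K : Module.End ℂ V) (m : ℂ) (k : ℕ) : Submodule ℂ V :=
  LinearMap.ker ((K - m • (1 : Module.End ℂ V)) ^ k)

/-- The ascent: the smallest `k` at which a chain of null spaces `N k` satisfies
`N k = N (k+1)`. -/
def IsAscent {E : Type*} [AddCommMonoid E] [Module ℂ E] (N : ℕ → Submodule ℂ E) (k : ℕ) : Prop :=
  IsLeast {m | N m = N (m + 1)} k

/-- `(u, λ) ∈ (V ∖ {0}) × ℂ` is an eigenpair: `A(u,v) = λ (u,v)` for all `v ∈ V`. -/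
def IsEigenpair (aR : ℂ) (b : ℝ) (c : ℂ) (u : V) (lam : ℂ) : Prop :=
  u ≠ 0 ∧ ∀ v : V, opA aR b c u v = lam * opI u v

/-- `s` is a holomorphic branch of `λ ↦ √(λ/d)` near `λ₀`. -/
def IsSqrtBranch (s : ℂ → ℂ) (d lam0 : ℂ) : Prop :=
  AnalyticAt ℂ s lam0 ∧ ∀ᶠ z in 𝓝 lam0, s z ^ 2 = z / d

/-- `v^L(λ,x) = sin (μ_L x)` for `μ_L = √λ`. -/
def vL (muL : ℂ) (x : ℝ) : ℂ := Complex.sin (muL * x)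

/-- `v^R(λ,x) = c₁ sin (μ_R x) + c₂ cos (μ_R x)` for `μ_R = √(λ/aR)`, with `c₁`, `c₂` chosen such
that `aR ∂ₓ v^R(λ,1) + c v^R(λ,1) = 0`. -/
def vR (aR c muR : ℂ) (x : ℝ) : ℂ :=
  (aR * muR * Complex.sin muR - c * Complex.cos muR) * Complex.sin (muR * x) +
    (aR * muR * Complex.cos muR + c * Complex.sin muR) * Complex.cos (muR * x)

/-- The function `v^R` satisfies the Robin condition at `x = 1`. -/
lemma vR_robin (aR c muR : ℂ) :
    aR * deriv (vR aR c muR) 1 + c * vR aR c muR 1 = 0 := by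
  have hs : HasDerivAt (fun z : ℂ => muR * z) muR ((1 : ℝ) : ℂ) := by
    simpa using (hasDerivAt_id ((1 : ℝ) : ℂ)).const_mul muR
  have h := ((hs.csin.const_mul (aR * muR * Complex.sin muR - c * Complex.cos muR)).add
    (hs.ccos.const_mul (aR * muR * Complex.cos muR + c * Complex.sin muR))).comp_ofReal
  have h : HasDerivAt (vR aR c muR) _ 1 := h
  rw [h.deriv]
  simp only [vR, Complex.ofReal_one, mul_one]
  ring

/-- The matrix `M_{a,b,c}(λ)`, as a function of `μ_L = √λ` and `μ_R = √(λ/aR)`. -/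
def matM (aR : ℂ) (b : ℝ) (c muL muR : ℂ) : Matrix (Fin 2) (Fin 2) ℂ :=
  !![vL muL b, -vR aR c muR b; deriv (vL muL) b, -(aR * deriv (vR aR c muR) b)]

/-- The ansatz `A₁ v^L(λ,x)` for `x` in the left, `A₂ v^R(λ,x)` for `x` in the right
subinterval. -/
def ansatz (aR : ℂ) (b : ℝ) (c muL muR : ℂ) (A : Fin 2 → ℂ) (x : ℝ) : ℂ :=
  if x ≤ b then A 0 * vL muL x else A 1 * vR aR c muR x

/-- The coefficients `A(λ)` extend the eigenfunction `u` analytically in `λ`: they are analytic at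
`λ₀`, and for `λ = λ₀` the ansatz is `u`. -/
def Extends (aR : ℂ) (b : ℝ) (c : ℂ) (muL muR : ℂ → ℂ) (lam0 : ℂ) (u : V)
    (A : ℂ → Fin 2 → ℂ) : Prop :=
  AnalyticAt ℂ A lam0 ∧
    ∀ x : unitInterval, u.1 x = ansatz aR b c (muL lam0) (muR lam0) (A lam0) x

/-- The coefficients `A(λ)` solve the `i`-th of the two transmission equations `M(λ) A(λ) = 0`
near `λ₀`, this equation being nontrivial at `λ₀`. -/
def SolvesRow (aR : ℂ) (b : ℝ) (c : ℂ) (muL muR : ℂ → ℂ) (lam0 : ℂ) (A : ℂ → Fin 2 → ℂ)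
    (i : Fin 2) : Prop :=
  matM aR b c (muL lam0) (muR lam0) i ≠ 0 ∧
    ∀ᶠ z in 𝓝 lam0, (matM aR b c (muL z) (muR z)).mulVec (A z) i = 0

/-- The coefficients `A(λ)` solve both transmission equations `M(λ) A(λ) = 0` up to
`O((λ - λ₀)^ν)`. -/
def SolvesToOrder (aR : ℂ) (b : ℝ) (c : ℂ) (muL muR : ℂ → ℂ) (lam0 : ℂ) (A : ℂ → Fin 2 → ℂ)
    (ν : ℕ) : Prop :=
  (fun z => (matM aR b c (muL z) (muR z)).mulVec (A z)) =O[𝓝 lam0] fun z => (z - lam0) ^ ν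

end

end Transmission

namespace Transmission

noncomputable section

/-! Let u(λ) be A₁v^L on the left of b and A₂v^R on the right. Near λ_j each piece solves its
differential equation and its outer boundary condition, and the entries of M(λ)A(λ) are, up to sign,
the jumps of u and au' at b. Differentiating -(au')' = λu in λ gives (𝒜 - λ_j)u⁽ⁿ⁾ = n u⁽ⁿ⁻¹⁾ at
λ_j, weakly on all of (0,1), as long as the derivatives of MA up to order n vanish there. So
condition (*) produces a chain of ν generalized eigenfunctions (`exists_chain`).

This chain cannot be continued (`not_exists_continuation`). If (𝒜 - λ_j)w = u⁽ᵛ⁻¹⁾, with v standing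
for ν, then w - u⁽ᵛ⁾/ν is B₁v^L on the left and B₂v^R on the right, and the transmission conditions
for w become (MA)⁽ᵛ⁾ + νMB = 0 at λ_j. Now differentiate adj(M)(MA) = det(M)A. As MA and det M
vanish to order ν, this leaves adj(M)(MA)⁽ᵛ⁾ = (det M)⁽ᵛ⁾A at λ_j. The left side is -ν adj(M)MB = -ν
det(M)B = 0, hence A(λ_j) = 0, which is absurd (`eq_zero_of_mulVec_order`).

Eigenspaces are one-dimensional because M(λ_j) has a nonzero row. Over such an eigenspace a maximal
chain determines every null space: its first k members span the k-th one for k ≤ ν, and nothing new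
appears afterwards (`IsMaximalChain`). That one exactly solved transmission equation forces the
other to order ν is an elimination between the two rows (`isBigO_mulVec`). The solution operator
enters through (𝒜 + Λ)(K - μ) = -μ(𝒜 - λ_j) (`IsSolutionOperator.kerPow_eq`).

Weak and classical formulations are linked by the flux: 𝒜w = Ih holds iff au' agrees almost
everywhere with the primitive of -h whose value at 1 is -c w(1) (`opA_eq_opI_iff`). -/

instance : NullSingletonClass mu := by unfold mu; infer_instance

/-! ### Primitives, weak derivatives and the du Bois-Reymond lemma -/

/-- The primitive `x ↦ ∫₀ˣ g` of a function on `(0,1)`. -/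
def prim (g : ℝ → ℂ) (x : ℝ) : ℂ := ∫ t in (0 : ℝ)..x, g t ∂mu

lemma continuous_prim {g : ℝ → ℂ} (hg : Integrable g mu) : Continuous (prim g) := by
  exact hg.continuous_primitive 0

lemma prim_zero (g : ℝ → ℂ) : prim g 0 = 0 := by simp [prim]

lemma ae_mem_Ioo : ∀ᵐ x ∂mu, x ∈ Ioo (0 : ℝ) 1 := ae_restrict_mem measurableSet_Ioo

lemma mu_integral_eq_interval (f : ℝ → ℂ) : ∫ x, f x ∂mu = ∫ x in (0 : ℝ)..1, f x := by
  rw [intervalIntegral.integral_of_le zero_le_one, mu, integral_Ioc_eq_integral_Ioo]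

lemma mu_setIntegral_Ioc (f : ℝ → ℂ) {x y : ℝ} (hx : 0 ≤ x) (hxy : x ≤ y) (hy : y ≤ 1) :
    ∫ t in Ioc x y, f t ∂mu = ∫ t in x..y, f t := by
  rw [intervalIntegral.integral_of_le hxy, mu, Measure.restrict_restrict measurableSet_Ioc]
  refine setIntegral_congr_set ?_
  have h1 : (Ioo x y : Set ℝ) =ᵐ[volume] Ioc x y := Ioo_ae_eq_Ioc
  refine EventuallyLE.antisymm (Eventually.of_forall fun t ht => ht.1) ?_
  refine h1.symm.le.trans (Eventually.of_forall fun t (ht : t ∈ Ioo x y) => ?_)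
  exact ⟨⟨ht.1, ht.2.le⟩, hx.trans_lt ht.1, ht.2.trans_le hy⟩

lemma prim_eq_interval (g : ℝ → ℂ) {x : ℝ} (hx : x ∈ Icc (0 : ℝ) 1) :
    prim g x = ∫ t in (0 : ℝ)..x, g t := by
  rw [prim, intervalIntegral.integral_of_le hx.1, mu_setIntegral_Ioc g le_rfl hx.1 hx.2]

lemma prim_one (g : ℝ → ℂ) : prim g 1 = ∫ x, g x ∂mu := by
  rw [prim_eq_interval g (by simp), mu_integral_eq_interval]

lemma integrable_continuous_mul {F g : ℝ → ℂ} (hF : Continuous F) (hg : Integrable g mu) :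
    Integrable (fun x => F x * g x) mu := by
  obtain ⟨C, hC⟩ := isCompact_Icc.exists_bound_of_continuousOn (hF.continuousOn (s := Icc 0 1))
  refine hg.bdd_mul (c := C) hF.aestronglyMeasurable ?_
  filter_upwards [ae_mem_Ioo] with x hx
  exact hC x ⟨hx.1.le, hx.2.le⟩

lemma integrable_continuous {F : ℝ → ℂ} (hF : Continuous F) : Integrable F mu := by
  simpa using integrable_continuous_mul hF (integrable_const (1 : ℂ))

/-- Integration by parts for a `C¹` function and a primitive. -/
lemma integral_deriv_mul_prim {F F' g : ℝ → ℂ} (hF : ∀ x, HasDerivAt F (F' x) x)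
    (hF' : Continuous F') (hg : Integrable g mu) :
    ∫ x, F' x * prim g x ∂mu + ∫ x, F x * g x ∂mu = F 1 * prim g 1 := by
  have hFc : Continuous F := continuous_iff_continuousAt.2 fun x => (hF x).continuousAt
  -- Fubini on the triangle 0 < t ≤ x; the indicator makes both iterated integrals have the same
  -- integrand.
  have hint : Integrable (Function.uncurry fun x t : ℝ =>
      (Ioc 0 x).indicator (fun _ => (1:ℂ)) t * (F' x * g t)) (mu.prod mu) := by
    have h1 : Integrable (fun p : ℝ × ℝ => F' p.1 * g p.2) (mu.prod mu) :=
      (integrable_continuous hF').mul_prod hg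
    have hm : MeasurableSet {p : ℝ × ℝ | p.2 ∈ Ioc 0 p.1} := by
      simp only [mem_Ioc]
      exact (measurableSet_lt measurable_const measurable_snd).inter
        (measurableSet_le measurable_snd measurable_fst)
    refine (h1.indicator hm).congr (Eventually.of_forall fun p => ?_)
    by_cases h : p.2 ∈ Ioc 0 p.1 <;> simp [Function.uncurry, indicator, h] <;> grind
  have e1 : ∫ x, F' x * prim g x ∂mu
      = ∫ x, ∫ t, (Ioc 0 x).indicator (fun _ => (1:ℂ)) t * (F' x * g t) ∂mu ∂mu := by
    refine integral_congr_ae ?_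
    filter_upwards [ae_mem_Ioo] with x hx
    rw [prim, intervalIntegral.integral_of_le hx.1.le, ← integral_indicator measurableSet_Ioc,
      ← integral_const_mul]
    refine integral_congr_ae (Eventually.of_forall fun t => ?_)
    by_cases h : t ∈ Ioc 0 x <;> simp [h]
  have e2 : ∫ t, ∫ x, (Ioc 0 x).indicator (fun _ => (1:ℂ)) t * (F' x * g t) ∂mu ∂mu
      = ∫ t, (F 1 - F t) * g t ∂mu := by
    refine integral_congr_ae ?_
    filter_upwards [ae_mem_Ioo] with t ht
    have : ∫ x, (Ioc 0 x).indicator (fun _ => (1:ℂ)) t * (F' x * g t) ∂mu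
        = ∫ x in Ioc t 1, F' x * g t ∂mu := by
      rw [← integral_indicator measurableSet_Ioc]
      -- Off the diagonal the half-open conditions t ∈ (0,x] and x ∈ (t,1] describe the same
      -- triangle.
      have hne : ∀ᵐ x ∂mu, x ≠ t := by
        simp [ae_iff]
      refine integral_congr_ae ?_
      filter_upwards [ae_mem_Ioo, hne] with x hx hxt
      have : t ∈ Ioc 0 x ↔ x ∈ Ioc t 1 := by
        simp only [mem_Ioc]
        constructor
        · rintro ⟨_, h⟩; exact ⟨lt_of_le_of_ne h (Ne.symm hxt), hx.2.le⟩
        · rintro ⟨h, _⟩; exact ⟨ht.1, h.le⟩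
      by_cases h : t ∈ Ioc 0 x
      · simp [h, this.1 h]
      · have h' := fun hh => h (this.2 hh)
        rw [indicator_of_notMem h, indicator_of_notMem h', zero_mul]
    rw [this, mu_setIntegral_Ioc _ ht.1.le ht.2.le le_rfl, intervalIntegral.integral_mul_const,
      intervalIntegral.integral_eq_sub_of_hasDerivAt (fun x _ => hF x)
        (hF'.intervalIntegrable _ _)]
  rw [e1, integral_integral_swap hint, e2, prim_one, ← integral_const_mul, ← integral_add]
  · refine integral_congr_ae (Eventually.of_forall fun t => ?_)
    simp only
    ring
  · exact integrable_continuous_mul (continuous_const.sub hFc) hg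
  · exact integrable_continuous_mul hFc hg

/-- Integration by parts against a test function, whose value at 1 is zero and kills the boundary
term. -/
lemma hasWeakDeriv_prim {g : ℝ → ℂ} (hg : Integrable g mu) : HasWeakDeriv (prim g) g := by
  intro φ h1 h2 h3
  have hd : ∀ x, HasDerivAt (fun x => (φ x : ℂ)) ((deriv φ x : ℝ) : ℂ) x := fun x =>
    ((h1.differentiable (by simp)) x).hasDerivAt.ofReal_comp
  have hc : Continuous fun x => ((deriv φ x : ℝ) : ℂ) :=
    Complex.continuous_ofReal.comp (h1.continuous_deriv (by simp))
  have hφ1 : φ 1 = 0 := by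
    by_contra h
    exact lt_irrefl _ (h3 (subset_tsupport φ h)).2
  have := integral_deriv_mul_prim hd hc hg
  simp only [hφ1, Complex.ofReal_zero, zero_mul] at this
  simp only [Complex.real_smul]
  exact eq_neg_of_add_eq_zero_left this

lemma HasWeakDeriv.congr {u v g : ℝ → ℂ} (h : HasWeakDeriv u g) (huv : u =ᵐ[mu] v) :
    HasWeakDeriv v g := by
  intro φ h1 h2 h3
  rw [← h φ h1 h2 h3]
  refine integral_congr_ae ?_
  filter_upwards [huv] with x hx
  rw [hx]

lemma extR_eq (u : C(unitInterval, ℂ)) (x : unitInterval) : extR u x = u x := by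
  simp [extR]

lemma extR_of_mem (u : C(unitInterval, ℂ)) {x : ℝ} (hx : x ∈ Icc (0 : ℝ) 1) :
    extR u x = u ⟨x, hx⟩ := extR_eq u ⟨x, hx⟩

/-- Two continuous functions which agree almost everywhere on `(0,1)` agree on `[0,1]`. -/
lemma eqOn_of_ae_eq {f g : ℝ → ℂ} (hf : Continuous f) (hg : Continuous g) (h : f =ᵐ[mu] g) :
    EqOn f g (Icc 0 1) := by
  have h1 : EqOn f g (Ioo 0 1) :=
    Measure.eqOn_open_of_ae_eq (μ := volume) h isOpen_Ioo hf.continuousOn hg.continuousOn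
  have := h1.closure hf hg
  rwa [closure_Ioo zero_ne_one] at this

/-- The du Bois-Reymond lemma. -/
lemma HasWeakDeriv.eq_const {u : ℝ → ℂ} (hu : Continuous u) (h : HasWeakDeriv u 0) :
    ∃ k, ∀ x ∈ Icc (0 : ℝ) 1, u x = k := by
  -- A test function of mean zero is the derivative of a test function, namely of its own primitive.
  have h0 : ∀ ψ : ℝ → ℝ, ContDiff ℝ ∞ ψ → HasCompactSupport ψ → tsupport ψ ⊆ Ioo (0 : ℝ) 1 →
      ∫ x, ψ x = 0 → ∫ x, ψ x • u x ∂mu = 0 := by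
    intro ψ h1 h2 h3 h4
    -- A compact interval inside (0,1) carrying ψ will also carry its primitive; for ψ = 0 the
    -- choice is arbitrary.
    obtain ⟨α, β, hα, hβ, hs⟩ : ∃ α β : ℝ, 0 < α ∧ β < 1 ∧ tsupport ψ ⊆ Icc α β := by
      by_cases hne : (tsupport ψ).Nonempty
      · obtain ⟨α, hα, hα'⟩ := h2.isCompact.exists_isLeast hne
        obtain ⟨β, hβ, hβ'⟩ := h2.isCompact.exists_isGreatest hne
        exact ⟨α, β, (h3 hα).1, (h3 hβ).2, fun x hx => ⟨hα' hx, hβ' hx⟩⟩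
      · rw [not_nonempty_iff_eq_empty.1 hne]
        exact ⟨1/2, 1/2, by norm_num, by norm_num, empty_subset _⟩
    have hz : ∀ x, x ∉ Icc α β → ψ x = 0 := fun x hx => by
      by_contra hh
      exact hx (hs (subset_tsupport ψ hh))
    have hd : ∀ x, HasDerivAt (fun x => ∫ t in (0:ℝ)..x, ψ t) (ψ x) x := fun x =>
      intervalIntegral.integral_hasDerivAt_right (h1.continuous.intervalIntegrable _ _)
        h1.continuous.aestronglyMeasurable.stronglyMeasurableAtFilter h1.continuous.continuousAt
    have hderiv : deriv (fun x => ∫ t in (0:ℝ)..x, ψ t) = ψ := funext fun x => (hd x).deriv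
    have hφ0 : ∀ x, x ∉ Icc α β → ∫ t in (0:ℝ)..x, ψ t = 0 := by
      intro x hx
      rw [mem_Icc, not_and_or, not_le, not_le] at hx
      have hlow : ∀ y ≤ α, ∫ t in (0:ℝ)..y, ψ t = 0 := by
        intro y hy
        refine intervalIntegral.integral_zero_ae ?_
        have hne : ∀ᵐ t : ℝ, t ≠ α := by simp [ae_iff]
        filter_upwards [hne] with t hta ht
        refine hz t fun hh => ?_
        rcases le_total 0 y with h | h
        · rw [uIoc_of_le h] at ht
          exact hta (le_antisymm (ht.2.trans hy) hh.1)
        · rw [uIoc_of_ge h] at ht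
          linarith [ht.2, hh.1]
      rcases hx with hx | hx
      · exact hlow x hx.le
      -- To the right of β the primitive is the full integral, which is zero. If β ≤ α, then ψ
      -- vanishes off a single point.
      · rcases le_total α β with hab | hab
        · rw [intervalIntegral.integral_eq_integral_of_support_subset, h4]
          intro t ht
          have := hs (subset_tsupport ψ ht)
          rcases le_or_gt α 0 with h | h
          · linarith
          exact ⟨h.trans_le this.1, this.2.trans hx.le⟩
        · have : ∀ t, ψ t = 0 ∨ t = α := by
            intro t
            by_cases ht : t ∈ Icc α β
            · right; exact le_antisymm (ht.2.trans hab) ht.1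
            · left; exact hz t ht
          refine intervalIntegral.integral_zero_ae ?_
          have hne : ∀ᵐ t : ℝ, t ≠ α := by simp [ae_iff]
          filter_upwards [hne] with t hta _
          exact (this t).resolve_right hta
    have hsub : tsupport (fun x => ∫ t in (0:ℝ)..x, ψ t) ⊆ Icc α β := by
      refine closure_minimal (fun x hx => ?_) isClosed_Icc
      by_contra hh
      exact hx (hφ0 x hh)
    have := h (fun x => ∫ t in (0:ℝ)..x, ψ t)
      (by
        rw [contDiff_infty_iff_deriv, hderiv]
        exact ⟨fun x => (hd x).differentiableAt, h1⟩)
      (HasCompactSupport.intro isCompact_Icc hφ0)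
      (hsub.trans fun x hx => ⟨hα.trans_le hx.1, hx.2.trans_lt hβ⟩)
    rw [hderiv] at this
    rw [this]
    simp
  -- A bump of nonzero mean: subtracting a multiple of it makes any test function mean-free, and the
  -- constant must be the ρ-weighted mean of u.
  obtain ⟨ρ, hρs, hρc, hρd, hρr, hρ1⟩ := exists_contDiff_tsupport_subset (E := ℝ) (n := ⊤)
    (s := Ioo (0:ℝ) 1) (x := 1/2) (Ioo_mem_nhds (by norm_num) (by norm_num))
  have hJ : ∫ x, ρ x ≠ 0 := by
    refine (hρd.continuous.integral_pos_of_hasCompactSupport_nonneg_nonzero hρc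
      (fun x => (hρr (mem_range_self x)).1) (x := 1/2) (by rw [hρ1]; exact one_ne_zero)).ne'
  have hui : Integrable u mu := integrable_continuous hu
  have hint : ∀ ψ : ℝ → ℝ, Continuous ψ → HasCompactSupport ψ →
      Integrable (fun x => ψ x • u x) mu := fun ψ h1 h2 => integrable_smul_of_bdd h1 h2 hui
  set k : ℂ := (∫ x, ρ x • u x ∂mu) / ((∫ x, ρ x : ℝ) : ℂ) with hk
  refine ⟨k, fun x hx => ?_⟩
  have key : ∀ᵐ x ∂(volume : Measure ℝ), x ∈ Ioo (0 : ℝ) 1 → u x - k = 0 := by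
    refine isOpen_Ioo.ae_eq_zero_of_integral_contDiff_smul_eq_zero
      ((hu.sub continuous_const).locallyIntegrable.locallyIntegrableOn _) ?_
    intro ψ h1 h2 h3
    have hψi : Integrable ψ := h1.continuous.integrable_of_hasCompactSupport h2
    have hρi : Integrable ρ := hρd.continuous.integrable_of_hasCompactSupport hρc
    set q : ℝ := (∫ x, ψ x) / ∫ x, ρ x with hq
    have hsub : tsupport (fun x => ψ x - q * ρ x) ⊆ Ioo (0 : ℝ) 1 :=
      (tsupport_sub ψ (fun x => q * ρ x)).trans
        (union_subset h3 ((tsupport_mul_subset_right (f := fun _ => q)).trans hρs))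
    have e := h0 (fun x => ψ x - q * ρ x) (h1.sub (contDiff_const.mul hρd))
      (h2.sub (hρc.mul_left (f := fun _ => q))) hsub
      (by rw [integral_sub hψi (hρi.const_mul q), integral_const_mul, hq]
          field_simp
          ring)
    have e' : ∫ x, ψ x • u x ∂mu = q * ∫ x, ρ x • u x ∂mu := by
      rw [← integral_const_mul, ← sub_eq_zero,
        ← integral_sub (hint ψ h1.continuous h2) ((hint ρ hρd.continuous hρc).const_mul _), ← e]
      refine integral_congr_ae (Eventually.of_forall fun x => ?_)
      simp only [Complex.real_smul]
      push_cast
      ring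
    have hz : ∀ x, x ∉ Ioo (0 : ℝ) 1 → ψ x = 0 := fun x hx => by
      by_contra hh
      exact hx (h3 (subset_tsupport ψ hh))
    have e2 : ∫ x, ψ x • (u x - k) = ∫ x, ψ x • (u x - k) ∂mu :=
      (setIntegral_eq_integral_of_forall_compl_eq_zero fun x hx => by simp [hz x hx]).symm
    have e3 : ∫ x, (ψ x : ℂ) * k ∂mu = (∫ x, ψ x : ℝ) * k := by
      rw [integral_mul_const, integral_complex_ofReal, mu,
        setIntegral_eq_integral_of_forall_compl_eq_zero hz]
    have hψk : Integrable (fun x => (ψ x : ℂ) * k) mu := (hψi.restrict.ofReal).mul_const k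
    rw [e2]
    calc ∫ x, ψ x • (u x - k) ∂mu = ∫ x, (ψ x • u x - (ψ x : ℂ) * k) ∂mu := by
          refine integral_congr_ae (Eventually.of_forall fun x => ?_)
          simp only [Complex.real_smul]
          ring
      _ = 0 := by
          rw [integral_sub (hint ψ h1.continuous h2) hψk, e3, e', hq, hk]
          have : ((∫ x, ρ x : ℝ) : ℂ) ≠ 0 := Complex.ofReal_ne_zero.2 hJ
          push_cast
          field_simp
          ring
  have : u =ᵐ[mu] fun _ => k := by
    filter_upwards [(ae_restrict_iff' measurableSet_Ioo).2 key] with x hx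
    exact sub_eq_zero.1 hx
  exact eqOn_of_ae_eq hu continuous_const this hx

/-- The primitive of an `L²` function, as an element of `V`. -/
def primV (g : L2) : V :=
  ⟨⟨fun x => prim g x, (continuous_prim (integrable_L2 g)).comp continuous_subtype_val⟩,
    ⟨g, (hasWeakDeriv_prim (integrable_L2 g)).congr (by
      filter_upwards [ae_mem_Ioo] with x hx
      rw [extR_of_mem _ ⟨hx.1.le, hx.2.le⟩]
      rfl)⟩, prim_zero g⟩

lemma D_eq {u : V} {g : L2} (h : HasWeakDeriv (extR u.1) g) : D u = g :=
  (hasWeakDeriv_D u).unique h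

lemma D_primV (g : L2) : D (primV g) = g :=
  D_eq ((hasWeakDeriv_prim (integrable_L2 g)).congr (by
      filter_upwards [ae_mem_Ioo] with x hx
      rw [extR_of_mem _ ⟨hx.1.le, hx.2.le⟩]
      rfl))

lemma V_ext {u v : V} (h : ∀ x, u.1 x = v.1 x) : u = v :=
  Subtype.ext (ContinuousMap.ext h)

/-- By du Bois-Reymond u is constant, and u(0) = 0 fixes the constant. Together with `D_primV` this
makes `D` a bijection onto L², so that test functions can be prescribed through their derivative. -/
lemma eq_zero_of_D_eq_zero {u : V} (h : D u = 0) : u = 0 := by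
  have h1 := hasWeakDeriv_D u
  rw [h] at h1
  have h2 : HasWeakDeriv (extR u.1) 0 := by
    intro φ a1 a2 a3
    rw [h1 φ a1 a2 a3]
    congr 1
    refine integral_congr_ae ?_
    filter_upwards [Lp.coeFn_zero ℂ 2 mu] with x hx
    rw [hx]
  obtain ⟨k, hk⟩ := h2.eq_const (continuous_ext u.1)
  have hk' : ∀ x : unitInterval, u.1 x = k := fun x => by
    rw [← extR_eq]
    exact hk x x.2
  refine V_ext fun x => ?_
  rw [hk' x, ← hk' 0, u.2.2]
  rfl

lemma primV_D (u : V) : primV (D u) = u := by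
  rw [← sub_eq_zero]
  refine eq_zero_of_D_eq_zero ?_
  rw [map_sub, D_primV, sub_self]

lemma V_apply (u : V) (x : unitInterval) : u.1 x = prim (D u) x := by
  conv_lhs => rw [← primV_D u]
  rfl

lemma extR_eq_prim (u : V) {x : ℝ} (hx : x ∈ Icc (0 : ℝ) 1) : extR u.1 x = prim (D u) x := by
  rw [extR_of_mem _ hx, V_apply]

/-! ### The weak equation in terms of the flux -/

lemma opA_apply (aR : ℂ) (b : ℝ) (c : ℂ) (u v : V) :
    opA aR b c u v = ∫ x, coeff aR b x * D u x * conj (D v x) ∂mu + c * u.1 1 * conj (v.1 1) := rfl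

lemma opI_apply (u v : V) : opI u v = ∫ x, extR u.1 x * conj (extR v.1 x) ∂mu := rfl

lemma prim_conj (g : ℝ → ℂ) {x : ℝ} (hx : x ∈ Icc (0 : ℝ) 1) :
    prim (fun t => conj (g t)) x = conj (prim g x) := by
  simp only [prim, intervalIntegral.integral_of_le hx.1]
  exact integral_conj

lemma integrable_conj_D (v : V) : Integrable (fun t => conj (D v t)) mu :=
  ((Lp.memLp (D v)).star).integrable (by norm_num)

lemma memLp_coeff_mul (aR : ℂ) (b : ℝ) (g : L2) : MemLp (fun x => coeff aR b x * g x) 2 mu := by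
  have hm : Measurable (coeff aR b) :=
    Measurable.ite measurableSet_Iio measurable_const measurable_const
  refine (Lp.memLp g).of_le_mul (c := max 1 ‖aR‖)
    (hm.aestronglyMeasurable.mul (Lp.aestronglyMeasurable g)) (Eventually.of_forall fun x => ?_)
  rw [norm_mul]
  gcongr
  unfold coeff
  split_ifs <;> simp

lemma memLp_continuous {F : ℝ → ℂ} (hF : Continuous F) : MemLp F 2 mu := by
  obtain ⟨C, hC⟩ := isCompact_Icc.exists_bound_of_continuousOn (hF.continuousOn (s := Icc 0 1))
  refine MemLp.of_bound hF.aestronglyMeasurable C ?_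
  filter_upwards [ae_mem_Ioo] with x hx
  exact hC x ⟨hx.1.le, hx.2.le⟩

/-- The form minus the right-hand side, in terms of the flux `F` of the right-hand side. -/
lemma opA_sub_opI_eq {aR : ℂ} {b : ℝ} {c : ℂ} {w h : V} {F : ℝ → ℂ}
    (hF : ∀ x, HasDerivAt F (-extR h.1 x) x) (hF1 : F 1 = -(c * w.1 1)) (v : V) :
    opA aR b c w v - opI h v = ∫ x, (coeff aR b x * D w x - F x) * conj (D v x) ∂mu := by
  have hFc : Continuous F := continuous_iff_continuousAt.2 fun x => (hF x).continuousAt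
  have h1 := integral_deriv_mul_prim hF (continuous_ext h.1).neg (integrable_conj_D v)
  have h2 : ∫ x, -extR h.1 x * prim (fun t => conj (D v t)) x ∂mu = - opI h v := by
    rw [opI_apply, ← integral_neg]
    refine integral_congr_ae ?_
    filter_upwards [ae_mem_Ioo] with x hx
    have hx' : x ∈ Icc (0 : ℝ) 1 := ⟨hx.1.le, hx.2.le⟩
    rw [prim_conj _ hx', extR_eq_prim v hx', neg_mul]
  have h3 : prim (fun t => conj (D v t)) 1 = conj (v.1 1) := by
    rw [prim_conj _ (by simp), V_apply]
    rfl
  rw [h2, h3, hF1] at h1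
  have h4 : ∫ x, (coeff aR b x * D w x - F x) * conj (D v x) ∂mu
      = ∫ x, coeff aR b x * D w x * conj (D v x) ∂mu - ∫ x, F x * conj (D v x) ∂mu := by
    rw [← integral_sub (integrable_form aR b _ _)
      (integrable_continuous_mul hFc (integrable_conj_D v))]
    simp only [sub_mul]
  rw [h4, opA_apply]
  linear_combination h1

/-- Characterization of weak solutions through the flux. -/
lemma opA_eq_opI_iff {aR : ℂ} {b : ℝ} {c : ℂ} {w h : V} {F : ℝ → ℂ}
    (hF : ∀ x, HasDerivAt F (-extR h.1 x) x) (hF1 : F 1 = -(c * w.1 1)) :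
    opA aR b c w = opI h ↔ ∀ᵐ x ∂mu, coeff aR b x * D w x = F x := by
  have hFc : Continuous F := continuous_iff_continuousAt.2 fun x => (hF x).continuousAt
  constructor
  · intro h1
    have hm : MemLp (fun x => coeff aR b x * D w x - F x) 2 mu :=
      (memLp_coeff_mul aR b _).sub (memLp_continuous hFc)
    -- Test with the element of V whose derivative is the residual au' - F; the identity then says
    -- that the residual has norm zero.
    have h2 := opA_sub_opI_eq (aR := aR) (b := b) hF hF1 (primV (hm.toLp _))
    rw [h1, sub_self, D_primV] at h2
    have h3 : ∫ x, ‖coeff aR b x * D w x - F x‖ ^ 2 ∂mu = 0 := by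
      have h4 : (((∫ x, ‖coeff aR b x * D w x - F x‖ ^ 2 ∂mu : ℝ)) : ℂ) = 0 := by
        rw [h2, ← integral_complex_ofReal]
        refine integral_congr_ae ?_
        filter_upwards [hm.coeFn_toLp] with x hx
        rw [hx, Complex.mul_conj, Complex.normSq_eq_norm_sq]
      exact_mod_cast h4
    rw [integral_eq_zero_iff_of_nonneg (fun x => by positivity)
      (hm.integrable_norm_pow (by norm_num))] at h3
    filter_upwards [h3] with x hx
    have : ‖coeff aR b x * D w x - F x‖ = 0 := by simpa using hx
    exact sub_eq_zero.1 (norm_eq_zero.1 this)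
  · intro h1
    refine LinearMap.ext fun v => ?_
    rw [← sub_eq_zero, opA_sub_opI_eq hF hF1]
    refine integral_eq_zero_of_ae ?_
    filter_upwards [h1] with x hx
    simp [hx]

/-- The value is prescribed at 1 because the natural boundary condition fixes the flux there. -/
lemma exists_flux (h : V) (k : ℂ) :
    ∃ F : ℝ → ℂ, (∀ x, HasDerivAt F (-extR h.1 x) x) ∧ F 1 = k := by
  refine ⟨fun x => k - ∫ t in (1:ℝ)..x, extR h.1 t, fun x => ?_, by simp⟩
  have := (intervalIntegral.integral_hasDerivAt_right
    ((continuous_ext h.1).intervalIntegrable 1 x)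
    (continuous_ext h.1).aestronglyMeasurable.stronglyMeasurableAtFilter
    (continuous_ext h.1).continuousAt).const_sub k
  exact this

/-- Testing with u itself gives ∫|u|² = 0, and u is continuous. Thus V really is a subspace of V^×,
and preimages under I are unique. -/
lemma opI_injective : Function.Injective opI := by
  rw [← LinearMap.ker_eq_bot, LinearMap.ker_eq_bot']
  intro u hu
  have h1 : opI u u = 0 := by rw [hu]; rfl
  have h3 : ∫ x, ‖extR u.1 x‖ ^ 2 ∂mu = 0 := by
    have h4 : (((∫ x, ‖extR u.1 x‖ ^ 2 ∂mu : ℝ)) : ℂ) = 0 := by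
      rw [← h1, ← integral_complex_ofReal, opI_apply]
      refine integral_congr_ae (Eventually.of_forall fun x => ?_)
      simp only
      rw [Complex.mul_conj, Complex.normSq_eq_norm_sq]
    exact_mod_cast h4
  rw [integral_eq_zero_iff_of_nonneg (fun x => by positivity)
    ((memLp_ext u.1).integrable_norm_pow (by norm_num))] at h3
  have h5 : extR u.1 =ᵐ[mu] fun _ => 0 := by
    filter_upwards [h3] with x hx
    simpa using hx
  refine V_ext fun x => ?_
  rw [← extR_eq, eqOn_of_ae_eq (continuous_ext _) continuous_const h5 x.2]
  rfl

/-! ### Conjugation and symmetry of the form -/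

/-- Complex conjugation on `V`. -/
def conjV (u : V) : V := primV ((Lp.memLp (D u)).star.toLp _)

lemma D_conjV (u : V) : ∀ᵐ x ∂mu, D (conjV u) x = conj (D u x) := by
  rw [conjV, D_primV]
  exact MemLp.coeFn_toLp _

lemma prim_congr {f g : ℝ → ℂ} (h : f =ᵐ[mu] g) (x : ℝ) : prim f x = prim g x :=
  intervalIntegral.integral_congr_ae (by filter_upwards [h] with t ht _ using ht)

lemma conjV_apply (u : V) (x : unitInterval) : (conjV u).1 x = conj (u.1 x) := by
  rw [V_apply, V_apply, ← prim_conj _ x.2]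
  exact prim_congr (D_conjV u) x

lemma extR_conjV (u : V) {x : ℝ} (hx : x ∈ Icc (0 : ℝ) 1) :
    extR (conjV u).1 x = conj (extR u.1 x) := by
  rw [extR_of_mem _ hx, extR_of_mem _ hx, conjV_apply]

/-- The sesquilinear form comes from a symmetric bilinear form. -/
lemma opA_conjV_symm (aR : ℂ) (b : ℝ) (c : ℂ) (u v : V) :
    opA aR b c u (conjV v) = opA aR b c v (conjV u) := by
  rw [opA_apply, opA_apply, conjV_apply, conjV_apply]
  congr 1
  · refine integral_congr_ae ?_
    filter_upwards [D_conjV u, D_conjV v] with x hu hv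
    rw [hu, hv, Complex.conj_conj, Complex.conj_conj]
    ring
  · simp only [Complex.conj_conj]
    ring

lemma opI_conjV_symm (u v : V) : opI u (conjV v) = opI v (conjV u) := by
  rw [opI_apply, opI_apply]
  refine integral_congr_ae ?_
  filter_upwards [ae_mem_Ioo] with x hx
  have hx' : x ∈ Icc (0 : ℝ) 1 := ⟨hx.1.le, hx.2.le⟩
  rw [extR_conjV _ hx', extR_conjV _ hx', Complex.conj_conj, Complex.conj_conj, mul_comm]

/-! ### The oscillator equation and its trigonometric solutions -/

lemma hasDerivAt_csin (m : ℂ) (x0 x : ℝ) : HasDerivAt (fun x : ℝ => Complex.sin (m * (x - x0)))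
    (m * Complex.cos (m * (x - x0))) x := by
  have h : HasDerivAt (fun z : ℂ => m * (z - x0)) m (x : ℂ) := by
    simpa using ((hasDerivAt_id (x : ℂ)).sub_const (x0 : ℂ)).const_mul m
  have := h.csin.comp_ofReal
  rwa [mul_comm] at this

lemma hasDerivAt_ccos (m : ℂ) (x0 x : ℝ) : HasDerivAt (fun x : ℝ => Complex.cos (m * (x - x0)))
    (-(m * Complex.sin (m * (x - x0)))) x := by
  have h : HasDerivAt (fun z : ℂ => m * (z - x0)) m (x : ℂ) := by
    simpa using ((hasDerivAt_id (x : ℂ)).sub_const (x0 : ℂ)).const_mul m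
  have := h.ccos.comp_ofReal
  rwa [mul_comm, mul_neg] at this

lemma eq_of_hasDerivAt_zero {f : ℝ → ℂ} {s t : ℝ} (hf : ∀ x ∈ Icc s t, HasDerivAt f 0 x)
    {x y : ℝ} (hx : x ∈ Icc s t) (hy : y ∈ Icc s t) : f x = f y := by
  have h := constant_of_has_deriv_right_zero
    (fun x hx => (hf x hx).continuousAt.continuousWithinAt)
    (fun x hx => (hf x ⟨hx.1, hx.2.le⟩).hasDerivWithinAt)
  rw [h x hx, h y hy]

/-- Solutions of `z'' = -m² z` on an interval. -/
lemma mul_eq_of_oscillator {z z' : ℝ → ℂ} {m : ℂ} {s t : ℝ}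
    (hz : ∀ x ∈ Icc s t, HasDerivAt z (z' x) x)
    (hz' : ∀ x ∈ Icc s t, HasDerivAt z' (-(m ^ 2 * z x)) x) {x₀ x : ℝ} (hx₀ : x₀ ∈ Icc s t)
    (hx : x ∈ Icc s t) :
    m * z x = z' x₀ * Complex.sin (m * (x - x₀)) + m * z x₀ * Complex.cos (m * (x - x₀)) := by
  -- The vector (z', mz), rotated by the angle m(x - x₀), is constant; `h1` and `h2` are its
  -- components, and rotating back gives the formula.
  have h1 := eq_of_hasDerivAt_zero (f := fun x => z' x * Complex.cos (m * (x - x₀))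
      + m * z x * Complex.sin (m * (x - x₀))) (fun y hy => by
    convert! ((hz' y hy).mul (hasDerivAt_ccos m x₀ y)).add
      (((hz y hy).const_mul m).mul (hasDerivAt_csin m x₀ y)) using 1
    ring) hx hx₀
  have h2 := eq_of_hasDerivAt_zero (f := fun x => z' x * Complex.sin (m * (x - x₀))
      - m * z x * Complex.cos (m * (x - x₀))) (fun y hy => by
    convert! ((hz' y hy).mul (hasDerivAt_csin m x₀ y)).sub
      (((hz y hy).const_mul m).mul (hasDerivAt_ccos m x₀ y)) using 1
    ring) hx hx₀
  simp only [sub_self, mul_zero, Complex.sin_zero, Complex.cos_zero] at h1 h2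
  linear_combination Complex.sin (m * (x - x₀)) * h1 - Complex.cos (m * (x - x₀)) * h2
    - m * z x * Complex.sin_sq_add_cos_sq (m * (x - x₀))

/-- Centred at 1, the function shows its Cauchy data there, value a_R m and slope -cm; this is the
form that `mul_eq_of_oscillator` yields with x₀ = 1. -/
lemma vR_eq (aR c m : ℂ) (x : ℝ) :
    vR aR c m x = aR * m * Complex.cos (m * (x - 1)) - c * Complex.sin (m * (x - 1)) := by
  rw [mul_sub, mul_one, Complex.cos_sub, Complex.sin_sub, vR]
  ring

lemma hasDerivAt_vL (m : ℂ) (x : ℝ) : HasDerivAt (vL m) (m * Complex.cos (m * x)) x := by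
  have h := hasDerivAt_csin m 0 x
  simp only [Complex.ofReal_zero, sub_zero] at h
  exact h

lemma hasDerivAt_vR (aR c m : ℂ) (x : ℝ) : HasDerivAt (vR aR c m)
    (-(aR * m ^ 2 * Complex.sin (m * (x - 1))) - c * (m * Complex.cos (m * (x - 1)))) x := by
  have h := ((hasDerivAt_ccos m 1 x).const_mul (aR * m)).sub
    ((hasDerivAt_csin m 1 x).const_mul c)
  refine (h.congr_of_eventuallyEq (Eventually.of_forall fun y => ?_)).congr_deriv ?_
  · simp [vR_eq]
  · simp only [Complex.ofReal_one]
    ring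

/-! ### Piecewise regularity and transmission conditions -/

section Regularity

variable {aR : ℂ} {b : ℝ} {c : ℂ}

/-- Weak solutions are piecewise `C²`, and satisfy the transmission and boundary conditions. -/
lemma exists_pieces (haR : aR ≠ 0) (hb : b ∈ Ioo (0 : ℝ) 1) {w h : V}
    (hw : opA aR b c w = opI h) : ∃ F wL wR : ℝ → ℂ, (∀ x, HasDerivAt F (-extR h.1 x) x) ∧
      (∀ x, HasDerivAt wL (F x) x) ∧ (∀ x, HasDerivAt wR (F x / aR) x) ∧
      F 1 = -(c * w.1 1) ∧ (∀ x ∈ Icc 0 b, extR w.1 x = wL x) ∧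
      (∀ x ∈ Icc b 1, extR w.1 x = wR x) := by
  obtain ⟨F, hF, hF1⟩ := exists_flux h (-(c * w.1 1))
  have hFc : Continuous F := continuous_iff_continuousAt.2 fun x => (hF x).continuousAt
  have hae := (opA_eq_opI_iff hF hF1).1 hw
  have hi : ∀ {g : ℝ → ℂ}, Continuous g → ∀ s x, HasDerivAt (fun x => ∫ t in s..x, g t) (g x) x :=
    fun hg s x => intervalIntegral.integral_hasDerivAt_right (hg.intervalIntegrable s x)
      hg.aestronglyMeasurable.stronglyMeasurableAtFilter hg.continuousAt
  have hae' : ∀ᵐ x ∂(volume : Measure ℝ), x ∈ Ioo (0 : ℝ) 1 → coeff aR b x * D w x = F x :=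
    (ae_restrict_iff' measurableSet_Ioo).1 hae
  have hD : IntervalIntegrable (D w) volume 0 1 := by
    rw [intervalIntegrable_iff_integrableOn_Ioo_of_le zero_le_one]
    exact integrable_L2 _
  have hne : ∀ᵐ t : ℝ, t ≠ 1 := by simp [ae_iff]
  -- Each piece is integrated from the end where its value is known, 0 on the left and w(1) on the
  -- right, so both are defined on the whole line.
  refine ⟨F, fun x => ∫ t in (0:ℝ)..x, F t, fun x => w.1 1 + ∫ t in (1:ℝ)..x, F t / aR, hF,
    hi hFc 0, fun x => (hi (hFc.div_const aR) 1 x).const_add _, hF1, fun x hx => ?_,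
    fun x hx => ?_⟩
  · have hx' : x ∈ Icc (0 : ℝ) 1 := ⟨hx.1, hx.2.trans hb.2.le⟩
    rw [extR_eq_prim w hx', prim_eq_interval _ hx']
    have hneb : ∀ᵐ t : ℝ, t ≠ b := by simp [ae_iff]
    refine intervalIntegral.integral_congr_ae ?_
    filter_upwards [hae', hneb] with t ht htb hxt
    rw [uIoc_of_le hx.1] at hxt
    have hlt : t < b := lt_of_le_of_ne (hxt.2.trans hx.2) htb
    rw [← ht ⟨hxt.1, hlt.trans hb.2⟩, coeff, if_pos hlt, one_mul]
  · have hx' : x ∈ Icc (0 : ℝ) 1 := ⟨hb.1.le.trans hx.1, hx.2⟩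
    have h1 : w.1 1 = prim (D w) 1 := V_apply w 1
    simp only
    rw [extR_eq_prim w hx', h1, prim_eq_interval _ hx', prim_eq_interval _ (by simp),
      ← intervalIntegral.integral_add_adjacent_intervals (b := x) (c := 1),
      intervalIntegral.integral_symm x 1 (f := fun t => F t / aR), add_assoc]
    · refine left_eq_add.2 ?_
      rw [add_neg_eq_zero]
      refine intervalIntegral.integral_congr_ae ?_
      filter_upwards [hae', hne] with t ht ht1 hxt
      rw [uIoc_of_le hx.2] at hxt
      have hlt : b < t := hx.1.trans_lt hxt.1
      rw [← ht ⟨hb.1.trans hlt, lt_of_le_of_ne hxt.2 ht1⟩, coeff, if_neg hlt.not_gt,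
        mul_div_cancel_left₀ _ haR]
    · refine hD.mono_set ?_
      rw [uIcc_of_le hx'.1, uIcc_of_le zero_le_one]
      exact Icc_subset_Icc_right hx'.2
    · refine hD.mono_set ?_
      rw [uIcc_of_le hx'.2, uIcc_of_le zero_le_one]
      exact Icc_subset_Icc_left hx'.1

/-- Up to a piecewise particular solution, a weak solution is a combination of `v^L` and `v^R`. -/
lemma exists_combination (haR : aR ≠ 0) (hb : b ∈ Ioo (0 : ℝ) 1) {lam mL mR : ℂ} (hlam : lam ≠ 0)
    (hmL : mL ^ 2 = lam) (hmR : mR ^ 2 = lam / aR) {w h : V} (hw : opA aR b c w = opI h)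
    {p p' q q' : ℝ → ℂ} (hp : ∀ x, HasDerivAt p (p' x) x) (hq : ∀ x, HasDerivAt q (q' x) x)
    (hp0 : p 0 = 0) (hq1 : aR * q' 1 + c * q 1 = 0)
    (hp' : ∀ x ∈ Icc 0 b, HasDerivAt p' (-extR h.1 x + lam * (extR w.1 x - p x)) x)
    (hq' : ∀ x ∈ Icc b 1, HasDerivAt q' ((-extR h.1 x + lam * (extR w.1 x - q x)) / aR) x) :
    ∃ B : Fin 2 → ℂ, (∀ x ∈ Icc 0 b, extR w.1 x = p x + B 0 * vL mL x) ∧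
      (∀ x ∈ Icc b 1, extR w.1 x = q x + B 1 * vR aR c mR x) ∧
      p b + B 0 * vL mL b = q b + B 1 * vR aR c mR b ∧
      p' b + B 0 * deriv (vL mL) b = aR * (q' b + B 1 * deriv (vR aR c mR) b) := by
  obtain ⟨F, wL, wR, hF, hwL, hwR, hF1, hL, hR⟩ := exists_pieces haR hb hw
  have hmL0 : mL ≠ 0 := by rintro rfl; exact hlam (by rw [← hmL]; simp)
  have hmR0 : mR ≠ 0 := by
    rintro rfl
    exact div_ne_zero hlam haR (by rw [← hmR]; simp)
  have hbL : b ∈ Icc 0 b := ⟨hb.1.le, le_rfl⟩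
  have hbR : b ∈ Icc b 1 := ⟨le_rfl, hb.2.le⟩
  -- Subtracting the particular solution leaves a homogeneous oscillator, anchored at the boundary
  -- point of each side.
  have hoscL : ∀ x ∈ Icc 0 b, mL * (wL x - p x) = _ := fun x hx =>
    mul_eq_of_oscillator (z := fun x => wL x - p x) (z' := fun x => F x - p' x) (m := mL)
      (fun x _ => (hwL x).sub (hp x))
      (fun x hx => ((hF x).sub (hp' x hx)).congr_deriv (by rw [hL x hx, hmL]; ring))
      (x₀ := 0) ⟨le_rfl, hb.1.le⟩ hx
  have hoscR : ∀ x ∈ Icc b 1, mR * (wR x - q x) = _ := fun x hx =>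
    mul_eq_of_oscillator (z := fun x => wR x - q x) (z' := fun x => F x / aR - q' x) (m := mR)
      (fun x _ => (hwR x).sub (hq x))
      (fun x hx => (((hF x).div_const aR).sub (hq' x hx)).congr_deriv (by
        rw [hR x hx, hmR]; ring))
      (x₀ := 1) ⟨hb.2.le, le_rfl⟩ hx
  have hwL0 : wL 0 = 0 := by
    rw [← hL 0 ⟨le_rfl, hb.1.le⟩, extR_eq_prim w (by simp), prim_zero]
  have hwR1 : w.1 1 = wR 1 := by
    rw [← hR 1 ⟨hb.2.le, le_rfl⟩]
    exact (extR_eq w.1 1).symm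
  set β : ℂ := F 1 / aR - q' 1 with hβ
  -- Both w and q satisfy the Robin condition, hence so does w - q; this ties its slope at 1 to its
  -- value and leaves one free multiple of v^R.
  have hrobin : aR * β = -(c * (wR 1 - q 1)) := by
    rw [hβ, mul_sub, mul_div_cancel₀ _ haR, hF1, hwR1]
    linear_combination -hq1
  have eL : ∀ x ∈ Icc 0 b, wL x = p x + (F 0 - p' 0) / mL * vL mL x := by
    intro x hx
    have := hoscL x hx
    simp only [hwL0, hp0, sub_self, mul_zero, zero_mul, add_zero, Complex.ofReal_zero,
      sub_zero] at this
    rw [vL]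
    field_simp
    linear_combination this
  have eR : ∀ x ∈ Icc b 1, wR x = q x + (wR 1 - q 1) / (aR * mR) * vR aR c mR x := by
    intro x hx
    have := hoscR x hx
    rw [Complex.ofReal_one] at this
    rw [vR_eq]
    field_simp
    linear_combination aR * this + Complex.sin (mR * (x - 1)) * hrobin
  -- The formula holds only on one side of b, so the slopes are compared as derivatives within the
  -- interval.
  have hdL : F b = p' b + (F 0 - p' 0) / mL * deriv (vL mL) b := by
    refine (uniqueDiffOn_Icc hb.1 b hbL).eq_deriv _ (hwL b).hasDerivWithinAt ?_
    exact ((hp b).add ((hasDerivAt_vL mL b).differentiableAt.hasDerivAt.const_mul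
      ((F 0 - p' 0) / mL))).hasDerivWithinAt.congr eL (eL b hbL)
  have hdR : F b / aR = q' b + (wR 1 - q 1) / (aR * mR) * deriv (vR aR c mR) b := by
    refine (uniqueDiffOn_Icc hb.2 b hbR).eq_deriv _ (hwR b).hasDerivWithinAt ?_
    exact ((hq b).add ((hasDerivAt_vR aR c mR b).differentiableAt.hasDerivAt.const_mul
      ((wR 1 - q 1) / (aR * mR)))).hasDerivWithinAt.congr eR (eR b hbR)
  refine ⟨![(F 0 - p' 0) / mL, (wR 1 - q 1) / (aR * mR)], fun x hx => (hL x hx).trans (eL x hx),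
    fun x hx => (hR x hx).trans (eR x hx), ?_, ?_⟩
  · exact (eL b hbL).symm.trans ((hL b hbL).symm.trans ((hR b hbR).trans (eR b hbR)))
  · simp only [Matrix.cons_val_zero, Matrix.cons_val_one]
    rw [← hdL, ← hdR, mul_div_cancel₀ _ haR]

/-- Piecewise `C¹` functions which are continuous and vanish at `0` belong to `V`. -/
lemma exists_V_of_pieces (hb : b ∈ Ioo (0 : ℝ) 1) {p p' q q' : ℝ → ℂ}
    (hp : ∀ x, HasDerivAt p (p' x) x) (hq : ∀ x, HasDerivAt q (q' x) x) (hp' : Continuous p')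
    (hq' : Continuous q') (hp0 : p 0 = 0) (hpq : p b = q b) :
    ∃ w : V, (∀ x ∈ Icc 0 b, extR w.1 x = p x) ∧ (∀ x ∈ Icc b 1, extR w.1 x = q x) ∧
      ∀ᵐ x ∂mu, D w x = if x < b then p' x else q' x := by
  have hm : MemLp (fun x => if x < b then p' x else q' x) 2 mu := by
    exact MemLp.piecewise (s := Iio b) measurableSet_Iio ((memLp_continuous hp').restrict _)
      ((memLp_continuous hq').restrict _)
  have hD : ∀ᵐ x ∂mu, D (primV (hm.toLp _)) x = if x < b then p' x else q' x := by
    rw [D_primV]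
    exact hm.coeFn_toLp
  have hi : ∀ s t : ℝ, 0 ≤ s → s ≤ t → t ≤ 1 → IntervalIntegrable
      (fun x => if x < b then p' x else q' x) volume s t := by
    intro s t h1 h2 h3
    rw [intervalIntegrable_iff_integrableOn_Ioo_of_le h2]
    exact IntegrableOn.mono_set (hm.integrable (by norm_num) : Integrable _ mu)
      (Ioo_subset_Ioo h1 h3)
  -- On the left no jump has been crossed; on the right the integral is split at b and p(b) = q(b)
  -- glues the pieces.
  have hL : ∀ x ∈ Icc 0 b, prim (fun x => if x < b then p' x else q' x) x = p x := by
    intro x hx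
    have hx' : x ∈ Icc (0 : ℝ) 1 := ⟨hx.1, hx.2.trans hb.2.le⟩
    have hneb : ∀ᵐ t : ℝ, t ≠ b := by simp [ae_iff]
    rw [prim_eq_interval _ hx', intervalIntegral.integral_congr_ae (g := p'),
      intervalIntegral.integral_eq_sub_of_hasDerivAt (fun x _ => hp x)
        (hp'.intervalIntegrable _ _), hp0, sub_zero]
    filter_upwards [hneb] with t htb hxt
    rw [uIoc_of_le hx.1] at hxt
    rw [if_pos (lt_of_le_of_ne (hxt.2.trans hx.2) htb)]
  refine ⟨primV (hm.toLp _), fun x hx => ?_, fun x hx => ?_, hD⟩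
  · have hx' : x ∈ Icc (0 : ℝ) 1 := ⟨hx.1, hx.2.trans hb.2.le⟩
    rw [extR_eq_prim _ hx', prim_congr hD, hL x hx]
  · have hx' : x ∈ Icc (0 : ℝ) 1 := ⟨hb.1.le.trans hx.1, hx.2⟩
    rw [extR_eq_prim _ hx', prim_congr hD, prim_eq_interval _ hx',
      ← intervalIntegral.integral_add_adjacent_intervals (hi 0 b le_rfl hb.1.le hb.2.le)
        (hi b x hb.1.le hx.1 hx.2), ← prim_eq_interval _ ⟨hb.1.le, hb.2.le⟩,
      hL b ⟨hb.1.le, le_rfl⟩, hpq, intervalIntegral.integral_congr (g := q'),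
      intervalIntegral.integral_eq_sub_of_hasDerivAt (fun x _ => hq x)
        (hq'.intervalIntegrable _ _)]
    · ring
    · intro t ht
      rw [uIcc_of_le hx.1] at ht
      simp only
      rw [if_neg ht.1.not_gt]

/-- Piecewise `C²` functions with the transmission and boundary conditions are weak solutions. -/
lemma opA_eq_opI_of_pieces (haR : aR ≠ 0) (hb : b ∈ Ioo (0 : ℝ) 1) {w h : V} {p' q' : ℝ → ℂ}
    (hD : ∀ᵐ x ∂mu, D w x = if x < b then p' x else q' x)
    (hp' : ∀ x ∈ Icc 0 b, HasDerivAt p' (-extR h.1 x) x)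
    (hq' : ∀ x ∈ Icc b 1, HasDerivAt q' (-extR h.1 x / aR) x)
    (hpq : p' b = aR * q' b) (hq1 : aR * q' 1 + c * w.1 1 = 0) : opA aR b c w = opI h := by
  obtain ⟨F, hF, hF1⟩ := exists_flux h (-(c * w.1 1))
  -- Flux and F have the same derivative on either side; they agree at 1 by the Robin condition,
  -- hence down to b, and the continuity of the flux carries this on to 0.
  have hR : ∀ x ∈ Icc b 1, aR * q' x = F x := by
    intro x hx
    have := eq_of_hasDerivAt_zero (f := fun x => aR * q' x - F x) (fun y hy => by
      refine (((hq' y hy).const_mul aR).sub (hF y)).congr_deriv ?_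
      rw [mul_div_cancel₀ _ haR, sub_self]) hx ⟨hb.2.le, le_rfl⟩
    rw [hF1] at this
    linear_combination this + hq1
  have hL : ∀ x ∈ Icc 0 b, p' x = F x := by
    intro x hx
    have := eq_of_hasDerivAt_zero (f := fun x => p' x - F x) (fun y hy => by
      refine ((hp' y hy).sub (hF y)).congr_deriv ?_
      rw [sub_self]) hx ⟨hb.1.le, le_rfl⟩
    rw [hpq, hR b ⟨le_rfl, hb.2.le⟩] at this
    linear_combination this
  rw [opA_eq_opI_iff hF hF1]
  filter_upwards [hD, ae_mem_Ioo] with x hx hx01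
  rw [hx, coeff]
  split_ifs with hxb
  · rw [one_mul, hL x ⟨hx01.1.le, hxb.le⟩]
  · exact hR x ⟨not_lt.1 hxb, hx01.2.le⟩

end Regularity

/-! ### Null spaces and maximal chains -/

section NullSpaces

variable {aR : ℂ} {b : ℝ} {c lam : ℂ}

lemma mem_nullSpace_succ {k : ℕ} {w : V} : w ∈ nullSpace aR b c lam (k + 1) ↔
    ∃ v ∈ nullSpace aR b c lam k, opA aR b c w = opI (v + lam • w) := by
  change (opA aR b c - lam • opI) w ∈ (nullSpace aR b c lam k).map opI ↔ _
  rw [Submodule.mem_map]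
  refine exists_congr fun v => and_congr_right fun _ => ?_
  rw [map_add, map_smul, LinearMap.sub_apply, LinearMap.smul_apply, eq_sub_iff_add_eq, eq_comm]

lemma nullSpace_le_succ (k : ℕ) : nullSpace aR b c lam k ≤ nullSpace aR b c lam (k + 1) := by
  induction k with
  | zero => exact bot_le
  | succ k ih =>
    intro w hw
    obtain ⟨v, hv, h⟩ := mem_nullSpace_succ.1 hw
    exact mem_nullSpace_succ.2 ⟨v, ih hv, h⟩

lemma nullSpace_mono : Monotone (nullSpace aR b c lam) := monotone_nat_of_le_succ nullSpace_le_succ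

lemma mem_nullSpace_one {w : V} : w ∈ nullSpace aR b c lam 1 ↔ opA aR b c w = opI (lam • w) := by
  rw [mem_nullSpace_succ]
  constructor
  · rintro ⟨v, hv, h⟩
    rwa [(Submodule.mem_bot ℂ).1 hv, zero_add] at h
  · intro h
    exact ⟨0, zero_mem _, by rwa [zero_add]⟩

/-- A maximal chain of generalized eigenfunctions, over a one-dimensional eigenspace. -/
structure IsMaximalChain (aR : ℂ) (b : ℝ) (c lam : ℂ) (ν : ℕ) (y : ℕ → V) : Prop where
  pos : 0 < ν
  ne_zero : y 0 ≠ 0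
  zero : opA aR b c (y 0) = opI (lam • y 0)
  succ : ∀ n, n + 1 < ν → opA aR b c (y (n + 1)) = opI (((n + 1 : ℕ) : ℂ) • y n + lam • y (n + 1))
  eigen : ∀ w, opA aR b c w = opI (lam • w) → ∃ k : ℂ, w = k • y 0
  maximal : ∀ w, opA aR b c w ≠ opI (y (ν - 1) + lam • w)

namespace IsMaximalChain

variable {ν : ℕ} {y : ℕ → V}

lemma mem (hy : IsMaximalChain aR b c lam ν y) {n : ℕ} (hn : n < ν) :
    y n ∈ nullSpace aR b c lam (n + 1) := by
  induction n with
  | zero => exact mem_nullSpace_one.2 hy.zero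
  | succ n ih =>
    exact mem_nullSpace_succ.2 ⟨_, Submodule.smul_mem _ _ (ih (by omega)), hy.succ n hn⟩

/-- Membership would descend the chain: if y (n+1) lay in the null space of index n+1, injectivity
of I would put (n+1) • y n into the one of index n, and so on down to y 0 = 0. -/
lemma notMem (hy : IsMaximalChain aR b c lam ν y) {n : ℕ} (hn : n < ν) :
    y n ∉ nullSpace aR b c lam n := by
  induction n with
  | zero => exact hy.ne_zero
  | succ n ih =>
    intro h
    obtain ⟨v, hv, hv'⟩ := mem_nullSpace_succ.1 h
    rw [hy.succ n hn] at hv'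
    have := add_right_cancel (opI_injective hv')
    rw [← this] at hv
    refine ih (by omega) ((Submodule.smul_mem_iff _ ?_).1 hv)
    exact_mod_cast n.succ_ne_zero

/-- Elements of the span of the chain have a preimage in the span, as long as the chain goes on. -/
lemma exists_preimage (hy : IsMaximalChain aR b c lam ν y) {k : ℕ} (hk : k < ν) {v : V}
    (hv : v ∈ Submodule.span ℂ (y '' Iio k)) :
    ∃ w ∈ Submodule.span ℂ (y '' Iio (k + 1)), opA aR b c w = opI (v + lam • w) := by
  induction hv using Submodule.span_induction with
  | mem v hv =>
    obtain ⟨n, hn, rfl⟩ := hv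
    have hn : n < k := hn
    have hne : ((n + 1 : ℕ) : ℂ) ≠ 0 := by exact_mod_cast n.succ_ne_zero
    -- The chain relation carries the factor n+1 from differentiating λu, so the preimage of y n is
    -- y (n+1) divided by it.
    refine ⟨((n + 1 : ℕ) : ℂ)⁻¹ • y (n + 1), Submodule.smul_mem _ _
      (Submodule.subset_span (mem_image_of_mem y (by simpa using hn))), ?_⟩
    rw [map_smul, hy.succ n (by omega), ← map_smul, smul_add, smul_smul, inv_mul_cancel₀ hne,
      one_smul, smul_comm]
  | zero => exact ⟨0, zero_mem _, by simp⟩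
  | add v v' _ _ h h' =>
    obtain ⟨w, hw, e⟩ := h
    obtain ⟨w', hw', e'⟩ := h'
    refine ⟨w + w', add_mem hw hw', ?_⟩
    rw [map_add, e, e', ← map_add, smul_add]
    congr 1
    abel
  | smul r v _ h =>
    obtain ⟨w, hw, e⟩ := h
    refine ⟨r • w, Submodule.smul_mem _ _ hw, ?_⟩
    rw [map_smul, e, ← map_smul, smul_add, smul_comm]

lemma exists_eq_add (hy : IsMaximalChain aR b c lam ν y) {v w w' : V}
    (h : opA aR b c w = opI (v + lam • w)) (h' : opA aR b c w' = opI (v + lam • w')) :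
    ∃ k : ℂ, w = w' + k • y 0 := by
  obtain ⟨k, hk⟩ := hy.eigen (w - w') (by
    rw [map_sub, h, h', ← map_sub, smul_sub]
    congr 1
    abel)
  exact ⟨k, by rw [← hk]; abel⟩

lemma zero_mem_span {k : ℕ} (hk : 0 < k) : y 0 ∈ Submodule.span ℂ (y '' Iio k) :=
  Submodule.subset_span (mem_image_of_mem y hk)

/-- Inductively, an element of the next null space differs from a preimage inside the span by an
eigenfunction, that is, by a multiple of y 0. -/
lemma nullSpace_eq_span (hy : IsMaximalChain aR b c lam ν y) {k : ℕ} (hk : k ≤ ν) :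
    nullSpace aR b c lam k = Submodule.span ℂ (y '' Iio k) := by
  refine le_antisymm ?_ ?_
  · induction k with
    | zero => exact bot_le
    | succ k ih =>
      intro w hw
      obtain ⟨v, hv, e⟩ := mem_nullSpace_succ.1 hw
      obtain ⟨w', hw', e'⟩ := hy.exists_preimage hk (ih (by omega) hv)
      obtain ⟨r, rfl⟩ := hy.exists_eq_add e e'
      exact add_mem hw' (Submodule.smul_mem _ _ (zero_mem_span k.succ_pos))
  · rw [Submodule.span_le]
    rintro _ ⟨n, hn, rfl⟩
    have hn : n < k := hn
    exact nullSpace_mono hn (hy.mem (hn.trans_le hk))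

lemma nullSpace_stable (hy : IsMaximalChain aR b c lam ν y) :
    nullSpace aR b c lam (ν + 1) = nullSpace aR b c lam ν := by
  refine le_antisymm (fun w hw => ?_) (nullSpace_le_succ ν)
  obtain ⟨v, hv, e⟩ := mem_nullSpace_succ.1 hw
  obtain ⟨m, rfl⟩ : ∃ m, ν = m + 1 := ⟨ν - 1, by have := hy.pos; omega⟩
  have hset : y '' Iio (m + 1) = insert (y m) (y '' Iio m) := by
    rw [← image_insert_eq]
    congr 1
    ext i
    simp only [mem_Iio, mem_insert_iff]
    omega
  rw [hy.nullSpace_eq_span le_rfl, hset, Submodule.mem_span_insert] at hv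
  obtain ⟨r, v', hv', rfl⟩ := hv
  obtain ⟨w', hw', e'⟩ := hy.exists_preimage (Nat.lt_succ_self m) hv'
  have e2 : opA aR b c (w - w') = opI (r • y m + lam • (w - w')) := by
    rw [map_sub, e, e', ← map_sub, smul_sub]
    congr 1
    abel
  -- The last member enters with coefficient r. If r ≠ 0, dividing w - w' by r would continue the
  -- chain, against maximality; so r = 0 and w - w' is a multiple of y 0.
  by_cases hr : r = 0
  · rw [hr, zero_smul, zero_add] at e2
    obtain ⟨k, hk⟩ := hy.eigen _ e2
    rw [hy.nullSpace_eq_span le_rfl, ← sub_add_cancel w w', hk]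
    exact add_mem (Submodule.smul_mem _ _ (zero_mem_span m.succ_pos)) hw'
  · refine absurd ?_ (hy.maximal (r⁻¹ • (w - w')))
    rw [map_smul, e2, ← map_smul, smul_add, smul_smul, inv_mul_cancel₀ hr, one_smul, smul_comm]
    rfl

lemma isAscent (hy : IsMaximalChain aR b c lam ν y) : IsAscent (nullSpace aR b c lam) ν := by
  refine ⟨hy.nullSpace_stable.symm, fun m hm => ?_⟩
  by_contra hlt
  have hlt : m < ν := not_le.1 hlt
  have hm : nullSpace aR b c lam m = nullSpace aR b c lam (m + 1) := hm
  refine hy.notMem hlt ?_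
  rw [hm]
  exact hy.mem hlt

/-- Each y n lies outside the span of its predecessors, which is the null space of index n; so the
chain is linearly independent. -/
lemma finrank_nullSpace (hy : IsMaximalChain aR b c lam ν y) {k : ℕ} (hk : k ≤ ν) :
    Module.finrank ℂ (nullSpace aR b c lam k) = k := by
  have hli : ∀ k ≤ ν, LinearIndependent ℂ fun i : Fin k => y i := by
    intro k
    induction k with
    | zero => intro _; exact linearIndependent_empty_type
    | succ k ih =>
      intro hk
      rw [linearIndependent_finSucc']
      refine ⟨ih (by omega), ?_⟩
      have : range (Fin.init fun i : Fin (k + 1) => y i) = y '' Iio k := by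
        ext v
        simp only [mem_range, mem_image, mem_Iio]
        exact ⟨fun ⟨i, hi⟩ => ⟨i, i.2, hi⟩, fun ⟨i, hi, hv⟩ => ⟨⟨i, hi⟩, hv⟩⟩
      rw [this, ← hy.nullSpace_eq_span (by omega)]
      exact hy.notMem (by simpa using hk)
  have h := finrank_span_eq_card (hli k hk)
  have hr : range (fun i : Fin k => y i) = y '' Iio k := by
    ext v
    simp only [mem_range, mem_image, mem_Iio]
    exact ⟨fun ⟨i, hi⟩ => ⟨i, i.2, hi⟩, fun ⟨i, hi, hv⟩ => ⟨⟨i, hi⟩, hv⟩⟩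
  rw [hy.nullSpace_eq_span hk, ← hr, h, Fintype.card_fin]

end IsMaximalChain

/-! ### The solution operator of the shifted form -/

/-- The shifted form is nondegenerate if it has a solution operator. -/
lemma IsSolutionOperator.injective {Lam : ℝ} {K : Module.End ℂ V}
    (hK : IsSolutionOperator aR b c Lam K) {z : V}
    (hz : opA aR b c z + (Lam : ℂ) • opI z = 0) : z = 0 := by
  -- By symmetry (v, conj z) equals the shifted form of z tested with conj (K v), which vanishes.
  have h : ∀ v, opI v (conjV z) = 0 := by
    intro v
    rw [← hK, opA_conjV_symm, opI_conjV_symm]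
    exact LinearMap.congr_fun hz (conjV (K v))
  refine opI_injective ?_
  rw [map_zero]
  refine LinearMap.ext fun v => ?_
  have hcc : conjV (conjV v) = v := V_ext fun x => by
    rw [conjV_apply, conjV_apply, Complex.conj_conj]
  rw [← hcc, opI_conjV_symm, h]
  rfl

lemma IsSolutionOperator.apply {Lam : ℝ} {K : Module.End ℂ V}
    (hK : IsSolutionOperator aR b c Lam K) (u : V) :
    opA aR b c (K u) + (Lam : ℂ) • opI (K u) = opI u :=
  LinearMap.ext fun v => hK u v

/-- If λ = -Λ, the eigenfunction would lie in the trivial kernel of the shifted form. -/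
lemma IsSolutionOperator.add_ne_zero {Lam : ℝ} {K : Module.End ℂ V}
    (hK : IsSolutionOperator aR b c Lam K) {u : V} (hu : u ≠ 0)
    (h : opA aR b c u = opI (lam • u)) : lam + Lam ≠ 0 := by
  intro h0
  refine hu (hK.injective ?_)
  rw [h, map_smul, ← add_smul, h0, zero_smul]

/-- With S = K - μ one has (𝒜 + Λ)S = -μ(𝒜 - λ). Hence (𝒜 - λ)w = Iv is equivalent to Sw = -μKv, and
K commutes with S, so the two recursions for the null spaces agree. -/
lemma IsSolutionOperator.kerPow_eq {Lam : ℝ} {K : Module.End ℂ V}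
    (hK : IsSolutionOperator aR b c Lam K) (h0 : lam + Lam ≠ 0) (k : ℕ) :
    kerPow K (lam + Lam)⁻¹ k = nullSpace aR b c lam k := by
  set m : ℂ := (lam + Lam)⁻¹ with hm
  have hm0 : m ≠ 0 := inv_ne_zero h0
  set S : Module.End ℂ V := K - m • (1 : Module.End ℂ V) with hS
  have hSw : ∀ w, S w = K w - m • w := fun w => rfl
  have hcomm : Commute K S :=
    (Commute.refl K).sub_right ((Commute.one_right K).smul_right m)
  -- the shifted operator applied to `S w`
  have hshift : ∀ w, opA aR b c (S w) + (Lam : ℂ) • opI (S w)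
      = -m • (opA aR b c w - lam • opI w) := by
    intro w
    have h1 := hK.apply w
    have h2 : opI w = (m * (lam + Lam)) • opI w := by
      rw [hm, inv_mul_cancel₀ h0, one_smul]
    rw [hSw, map_sub, map_sub, map_smul, map_smul]
    calc _ = (opA aR b c (K w) + (Lam : ℂ) • opI (K w))
          - m • (opA aR b c w + (Lam : ℂ) • opI w) := by module
      _ = (m * (lam + Lam)) • opI w - m • (opA aR b c w + (Lam : ℂ) • opI w) := by
          rw [h1, ← h2]
      _ = _ := by module
  induction k with
  | zero =>
    rw [kerPow, pow_zero]
    exact LinearMap.ker_id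
  | succ k ih =>
    ext w
    have hk : w ∈ kerPow K m (k + 1) ↔ S w ∈ kerPow K m k := by
      rw [kerPow, kerPow, LinearMap.mem_ker, LinearMap.mem_ker, pow_succ]
      rfl
    rw [hk, mem_nullSpace_succ]
    constructor
    · intro h
      -- Since the null spaces increase, (𝒜 - λ)Sw is again represented by an element v of the k-th
      -- one; then (𝒜 + Λ)Sw is represented by v + (λ + Λ)Sw.
      have hv : ∃ v ∈ nullSpace aR b c lam k, opA aR b c (S w) = opI (v + lam • S w) := by
        rw [ih] at h
        exact mem_nullSpace_succ.1 (nullSpace_le_succ k h)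
      obtain ⟨v, hv, e⟩ := hv
      rw [ih] at h
      refine ⟨(-m)⁻¹ • (v + (lam + Lam) • S w),
        Submodule.smul_mem _ _ (add_mem hv (Submodule.smul_mem _ _ h)), ?_⟩
      have h1 := hshift w
      rw [e] at h1
      have h2 : opA aR b c w - lam • opI w
          = (-m)⁻¹ • (opI (v + lam • S w) + (Lam : ℂ) • opI (S w)) := by
        rw [h1, smul_smul, inv_mul_cancel₀ (neg_ne_zero.2 hm0), one_smul]
      rw [sub_eq_iff_eq_add] at h2
      rw [h2]
      simp only [map_add, map_smul]
      module
    · rintro ⟨v, hv, e⟩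
      have h1 := hshift w
      have h2 := hK.apply v
      have h3 : S w = -m • K v := by
        rw [← sub_eq_zero]
        refine hK.injective ?_
        rw [map_sub, map_sub, map_smul, map_smul]
        calc _ = (opA aR b c (S w) + (Lam : ℂ) • opI (S w))
              - (-m) • (opA aR b c (K v) + (Lam : ℂ) • opI (K v)) := by module
          _ = 0 := by
            rw [h1, h2, e, map_add, map_smul]
            module
      rw [h3]
      refine Submodule.smul_mem _ _ ?_
      rw [← ih, kerPow, LinearMap.mem_ker] at hv
      rw [kerPow, LinearMap.mem_ker]
      have := (hcomm.pow_right k).eq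
      calc (S ^ k) (K v) = (K * S ^ k) v := by rw [this]; rfl
        _ = 0 := by rw [Module.End.mul_apply, hv, map_zero]

end NullSpaces

/-! ### Differentiation in the spectral parameter -/

lemma analyticAt_fderiv_apply {g : ℂ × ℂ → ℂ} {p : ℂ × ℂ} (hg : AnalyticAt ℂ g p)
    (v : ℂ × ℂ) : AnalyticAt ℂ (fun p => fderiv ℂ g p v) p :=
  ((ContinuousLinearMap.apply ℂ ℂ v).analyticAt _).comp hg.fderiv

lemma fderiv_fderiv_comm {g : ℂ × ℂ → ℂ} {p : ℂ × ℂ} (hg : AnalyticAt ℂ g p) (v w : ℂ × ℂ) :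
    fderiv ℂ (fun p => fderiv ℂ g p v) p w = fderiv ℂ (fun p => fderiv ℂ g p w) p v := by
  have h : ∀ v w, fderiv ℂ (fun p => fderiv ℂ g p v) p w = fderiv ℂ (fderiv ℂ g) p w v := by
    intro v w
    rw [fderiv_clm_apply hg.fderiv.differentiableAt (differentiableAt_const v)]
    simp
  rw [h, h]
  exact (hg.contDiffAt (n := ω)).isSymmSndFDerivAt_of_omega w v

lemma hasDerivAt_fst {g : ℂ × ℂ → ℂ} {z ξ : ℂ} (hg : AnalyticAt ℂ g (z, ξ)) :
    HasDerivAt (fun z => g (z, ξ)) (fderiv ℂ g (z, ξ) (1, 0)) z :=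
  (hg.differentiableAt.hasFDerivAt.comp_hasDerivAt z
    ((hasDerivAt_id z).prodMk (hasDerivAt_const z ξ)))

lemma hasDerivAt_snd {g : ℂ × ℂ → ℂ} {z ξ : ℂ} (hg : AnalyticAt ℂ g (z, ξ)) :
    HasDerivAt (fun ξ => g (z, ξ)) (fderiv ℂ g (z, ξ) (0, 1)) ξ :=
  (hg.differentiableAt.hasFDerivAt.comp_hasDerivAt ξ
    ((hasDerivAt_const ξ z).prodMk (hasDerivAt_id ξ)))

lemma eventually_analyticAt_prod {g : ℂ × ℂ → ℂ} {z ξ : ℂ} (hg : AnalyticAt ℂ g (z, ξ)) :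
    ∀ᶠ y in 𝓝 z, AnalyticAt ℂ g (y, ξ) :=
  ((Continuous.prodMk_left ξ).continuousAt (x := z)).eventually hg.eventually_analyticAt

/-- Induction on n over all g at once: one parameter derivative is absorbed into g, and symmetry of
the second derivative exchanges it with the derivative in ξ. -/
lemma hasDerivAt_iteratedDeriv_fderiv {z : ℂ} (n : ℕ) : ∀ {g : ℂ × ℂ → ℂ},
    (∀ ξ, AnalyticAt ℂ g (z, ξ)) → ∀ ξ, HasDerivAt (fun ξ => iteratedDeriv n (fun z => g (z, ξ)) z)
      (iteratedDeriv n (fun z => fderiv ℂ g (z, ξ) (0, 1)) z) ξ := by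
  induction n with
  | zero =>
    intro g hg ξ
    simpa using hasDerivAt_snd (hg ξ)
  | succ n ih =>
    intro g hg ξ
    have h1 : ∀ {g : ℂ × ℂ → ℂ} {ξ : ℂ}, AnalyticAt ℂ g (z, ξ) →
        iteratedDeriv (n + 1) (fun z => g (z, ξ)) z
          = iteratedDeriv n (fun z => fderiv ℂ g (z, ξ) (1, 0)) z := by
      intro g ξ hg
      rw [iteratedDeriv_succ']
      refine Filter.EventuallyEq.iteratedDeriv_eq n ?_
      filter_upwards [eventually_analyticAt_prod hg] with y hy
      exact (hasDerivAt_fst hy).deriv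
    have h2 := ih (g := fun p => fderiv ℂ g p (1, 0))
      (fun ξ => analyticAt_fderiv_apply (hg ξ) _) ξ
    rw [h1 (analyticAt_fderiv_apply (hg ξ) (0, 1))]
    refine (h2.congr_of_eventuallyEq (Eventually.of_forall fun ξ => h1 (hg ξ))).congr_deriv ?_
    refine Filter.EventuallyEq.iteratedDeriv_eq n ?_
    filter_upwards [eventually_analyticAt_prod (hg ξ)] with y hy
    exact fderiv_fderiv_comm hy _ _

/-- Differentiation in the variable commutes with differentiation in the parameter. -/
lemma hasDerivAt_iteratedDeriv {g g' : ℂ → ℂ → ℂ} {z : ℂ}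
    (hg : ∀ ξ, AnalyticAt ℂ (Function.uncurry g) (z, ξ))
    (hg' : ∀ z ξ, HasDerivAt (g z) (g' z ξ) ξ) (n : ℕ) (ξ : ℂ) :
    HasDerivAt (fun ξ => iteratedDeriv n (fun z => g z ξ) z)
      (iteratedDeriv n (fun z => g' z ξ) z) ξ := by
  refine (hasDerivAt_iteratedDeriv_fderiv n hg ξ).congr_deriv ?_
  refine Filter.EventuallyEq.iteratedDeriv_eq n ?_
  filter_upwards [eventually_analyticAt_prod (hg ξ)] with y hy
  exact (hasDerivAt_snd hy).unique (hg' y ξ)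

/-- Leibniz with a linear factor. This term becomes the coupling to the previous chain member; at n
= 0 the truncated index n - 1 is harmless because its factor is 0. -/
lemma iteratedDeriv_id_mul {f : ℂ → ℂ} {z : ℂ} (hf : AnalyticAt ℂ f z) (n : ℕ) :
    iteratedDeriv n (fun y => y * f y) z
      = z * iteratedDeriv n f z + n * iteratedDeriv (n - 1) f z := by
  induction n generalizing f with
  | zero => simp
  | succ n ih =>
    have h : iteratedDeriv (n + 1) (fun y => y * f y) z
        = iteratedDeriv n (fun y => f y + y * deriv f y) z := by
      rw [iteratedDeriv_succ']
      refine Filter.EventuallyEq.iteratedDeriv_eq n ?_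
      filter_upwards [hf.eventually_analyticAt] with y hy
      exact ((hasDerivAt_id y).mul hy.differentiableAt.hasDerivAt).deriv.trans (by simp)
    have hd := hf.deriv
    have hm : AnalyticAt ℂ (fun y => y * deriv f y) z := analyticAt_id.mul hd
    rw [h, iteratedDeriv_fun_add hf.contDiffAt hm.contDiffAt, ih hd,
      ← iteratedDeriv_succ']
    rcases n with _ | n
    · simp
      ring
    · rw [Nat.add_sub_cancel, ← iteratedDeriv_succ', Nat.add_sub_cancel]
      push_cast
      ring

/-- A combination of sine and cosine, with coefficients depending on a parameter `z`. -/
def wave (S C s : ℂ → ℂ) (z ξ : ℂ) : ℂ :=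
  S z * Complex.sin (s z * ξ) + C z * Complex.cos (s z * ξ)

lemma hasDerivAt_wave (S C s : ℂ → ℂ) (z ξ : ℂ) : HasDerivAt (wave S C s z)
    (wave (fun z => -(C z * s z)) (fun z => S z * s z) s z ξ) ξ := by
  have h : HasDerivAt (fun ξ : ℂ => s z * ξ) (s z) ξ := by
    simpa using (hasDerivAt_id ξ).const_mul (s z)
  refine ((h.csin.const_mul (S z)).add (h.ccos.const_mul (C z))).congr_deriv ?_
  simp only [wave]
  ring

section Wave

variable {S C s : ℂ → ℂ} {z d : ℂ}

lemma analyticAt_wave (hS : AnalyticAt ℂ S z) (hC : AnalyticAt ℂ C z) (hs : AnalyticAt ℂ s z)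
    (ξ : ℂ) : AnalyticAt ℂ (Function.uncurry (wave S C s)) (z, ξ) := by
  have h : ∀ {f : ℂ → ℂ}, AnalyticAt ℂ f z → AnalyticAt ℂ (fun p : ℂ × ℂ => f p.1) (z, ξ) :=
    fun hf => hf.comp analyticAt_fst
  have h1 : AnalyticAt ℂ (fun p : ℂ × ℂ => s p.1 * p.2) (z, ξ) := (h hs).mul analyticAt_snd
  have h2 : AnalyticAt ℂ (fun p : ℂ × ℂ => Complex.sin (s p.1 * p.2)) (z, ξ) :=
    Complex.analyticAt_sin.comp h1
  have h3 : AnalyticAt ℂ (fun p : ℂ × ℂ => Complex.cos (s p.1 * p.2)) (z, ξ) :=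
    Complex.analyticAt_cos.comp h1
  exact ((h hS).mul h2).add ((h hC).mul h3)

lemma analyticAt_wave_left (hS : AnalyticAt ℂ S z) (hC : AnalyticAt ℂ C z)
    (hs : AnalyticAt ℂ s z) (ξ : ℂ) : AnalyticAt ℂ (fun z => wave S C s z ξ) z := by
  have h : AnalyticAt ℂ (fun z : ℂ => (z, ξ)) z := analyticAt_id.prod analyticAt_const
  exact (analyticAt_wave hS hC hs ξ).comp (f := fun z : ℂ => (z, ξ)) h

/-- The `n`-th derivative of a wave with respect to the parameter. -/
def jet (S C s : ℂ → ℂ) (z : ℂ) (n : ℕ) (x : ℝ) : ℂ := iteratedDeriv n (fun z => wave S C s z x) z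

lemma hasDerivAt_jet (hS : AnalyticAt ℂ S z) (hC : AnalyticAt ℂ C z) (hs : AnalyticAt ℂ s z)
    (n : ℕ) (x : ℝ) : HasDerivAt (jet S C s z n)
      (jet (fun z => -(C z * s z)) (fun z => S z * s z) s z n x) x :=
  (hasDerivAt_iteratedDeriv (analyticAt_wave hS hC hs) (hasDerivAt_wave S C s) n x).comp_ofReal

/-- The differential equation for the derivatives with respect to the spectral parameter. -/
lemma hasDerivAt_jet_deriv (hS : AnalyticAt ℂ S z) (hC : AnalyticAt ℂ C z) (hs : AnalyticAt ℂ s z)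
    (hd : ∀ᶠ z in 𝓝 z, s z ^ 2 = z / d) (n : ℕ) (x : ℝ) :
    HasDerivAt (jet (fun z => -(C z * s z)) (fun z => S z * s z) s z n)
      (-(z * jet S C s z n x + n * jet S C s z (n - 1) x) / d) x := by
  have hC' : AnalyticAt ℂ (fun z => -(C z * s z)) z := (hC.mul hs).neg
  have hS' : AnalyticAt ℂ (fun z => S z * s z) z := hS.mul hs
  refine (hasDerivAt_jet hC' hS' hs n x).congr_deriv ?_
  -- Two derivatives in x multiply a wave by -s², which is -z/d only near the base point, where the
  -- branch identity holds.
  have h : (fun z => wave (fun z => -(S z * s z * s z)) (fun z => -(C z * s z) * s z) s z x)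
      =ᶠ[𝓝 z] fun z => (-1 / d) * (z * wave S C s z x) := by
    filter_upwards [hd] with z hz
    have hz' : -1 / d * z = -(s z) ^ 2 := by rw [hz]; ring
    rw [← mul_assoc, hz', wave, wave]
    ring
  have hw := analyticAt_wave_left hS hC hs x
  rw [jet, h.iteratedDeriv_eq, iteratedDeriv_const_mul_field, iteratedDeriv_id_mul hw]
  simp only [jet]
  ring

end Wave

/-! ### Orders of zeros of analytic functions -/

section Order

variable {f g : ℂ → ℂ} {z₀ : ℂ} {n : ℕ}

/-- If the order were k < n, dividing by (z - z₀)^k would make the nonvanishing cofactor O((z -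
z₀)^(n-k)), hence zero at z₀. -/
lemma natCast_le_analyticOrderAt_of_isBigO (hf : AnalyticAt ℂ f z₀)
    (h : f =O[𝓝 z₀] fun z => (z - z₀) ^ n) : n ≤ analyticOrderAt f z₀ := by
  by_contra hlt
  rw [not_le] at hlt
  obtain ⟨k, hk⟩ := ENat.ne_top_iff_exists.1 hlt.ne_top
  rw [← hk, Nat.cast_lt] at hlt
  obtain ⟨g, hg, hg0, hfg⟩ := (hf.analyticOrderAt_eq_natCast).1 hk.symm
  refine hg0 ?_
  have hO : g =O[𝓝[≠] z₀] fun z => (z - z₀) ^ (n - k) := by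
    obtain ⟨C, hC⟩ := h.bound
    refine Asymptotics.IsBigO.of_bound C ?_
    filter_upwards [hC.filter_mono nhdsWithin_le_nhds, hfg.filter_mono nhdsWithin_le_nhds,
      self_mem_nhdsWithin] with z h1 h2 h3
    have hz : 0 < ‖(z - z₀) ^ k‖ := norm_pos_iff.2 (pow_ne_zero _ (sub_ne_zero.2 h3))
    refine le_of_mul_le_mul_left ?_ hz
    rw [h2, norm_smul] at h1
    refine h1.trans (le_of_eq ?_)
    rw [mul_left_comm, ← norm_mul, ← pow_add, Nat.add_sub_cancel' hlt.le]
  have h1 : Tendsto (fun z => (z - z₀) ^ (n - k)) (𝓝[≠] z₀) (𝓝 0) := by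
    have : Continuous fun z : ℂ => (z - z₀) ^ (n - k) := by fun_prop
    have h2 := this.tendsto z₀
    rw [sub_self, zero_pow (by omega)] at h2
    exact h2.mono_left nhdsWithin_le_nhds
  exact tendsto_nhds_unique (hg.continuousAt.tendsto.mono_left nhdsWithin_le_nhds)
    (hO.trans_tendsto h1)

lemma isBigO_pow_iff (hf : AnalyticAt ℂ f z₀) : (f =O[𝓝 z₀] fun z => (z - z₀) ^ n) ↔
    ∀ i < n, iteratedDeriv i f z₀ = 0 := by
  rw [← natCast_le_analyticOrderAt_iff_iteratedDeriv_eq_zero hf]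
  refine ⟨natCast_le_analyticOrderAt_of_isBigO hf, fun h => ?_⟩
  obtain ⟨g, hg, hfg⟩ := (natCast_le_analyticOrderAt hf).1 h
  refine EventuallyEq.trans_isBigO hfg ?_
  have := (Asymptotics.isBigO_refl (fun z => (z - z₀) ^ n) (𝓝 z₀)).smul
    (hg.continuousAt.isBigO_one ℂ)
  simpa using this

/-- In the Leibniz sum only the term with all derivatives on f survives. -/
lemma iteratedDeriv_mul_of_eq_zero (hf : AnalyticAt ℂ f z₀) (hg : AnalyticAt ℂ g z₀)
    (h : ∀ i < n, iteratedDeriv i f z₀ = 0) :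
    iteratedDeriv n (fun z => f z * g z) z₀ = iteratedDeriv n f z₀ * g z₀ := by
  rw [iteratedDeriv_fun_mul hf.contDiffAt hg.contDiffAt, Finset.sum_range_succ,
    Finset.sum_eq_zero fun i hi => by rw [h i (Finset.mem_range.1 hi)]; ring]
  simp

lemma iteratedDeriv_of_hasSum {γ : ℕ → ℂ} (hf : AnalyticAt ℂ f z₀)
    (h : ∀ᶠ z in 𝓝 z₀, HasSum (fun l : ℕ => γ l * (z - z₀) ^ l) (f z)) (n : ℕ) :
    iteratedDeriv n f z₀ = n.factorial * γ n := by
  have h1 : HasFPowerSeriesAt f (FormalMultilinearSeries.ofScalars ℂ γ) z₀ := by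
    rw [hasFPowerSeriesAt_iff']
    filter_upwards [h] with z hz
    simpa [FormalMultilinearSeries.coeff_ofScalars, mul_comm] using hz
  have h2 := congrArg (fun p => p.coeff n)
    (h1.eq_formalMultilinearSeries (AnalyticAt.hasFPowerSeriesAt hf))
  simp only [FormalMultilinearSeries.coeff_ofScalars] at h2
  have : (n.factorial : ℂ) ≠ 0 := by exact_mod_cast n.factorial_ne_zero
  rw [h2]
  field_simp

end Order

/-! ### Analytic systems of two linear equations -/

section Matrix2

open Matrix

variable {M : ℂ → Matrix (Fin 2) (Fin 2) ℂ} {A : ℂ → Fin 2 → ℂ} {z₀ : ℂ} {n : ℕ}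

/-- The kernel of a nonzero row r is spanned by (r₁, -r₀). This gives one-dimensional eigenspaces
and, with r depending on λ, the analytic extension of an eigenfunction. -/
lemma exists_smul_of_row {r B : Fin 2 → ℂ} (hr : r ≠ 0) (h : r 0 * B 0 + r 1 * B 1 = 0) :
    ∃ t : ℂ, B 0 = t * r 1 ∧ B 1 = -(t * r 0) := by
  by_cases h0 : r 0 = 0
  · have h1 : r 1 ≠ 0 := fun h1 => hr (by ext i; fin_cases i <;> simp [h0, h1])
    refine ⟨B 0 / r 1, by field_simp, ?_⟩
    rw [h0, zero_mul, zero_add] at h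
    rw [h0, (mul_eq_zero.1 h).resolve_left h1]
    simp
  · refine ⟨-(B 1 / r 0), ?_, by field_simp⟩
    field_simp
    linear_combination h

lemma analyticAt_mulVec (hM : ∀ i j, AnalyticAt ℂ (fun z => M z i j) z₀)
    (hA : ∀ j, AnalyticAt ℂ (fun z => A z j) z₀) (i : Fin 2) :
    AnalyticAt ℂ (fun z => (M z *ᵥ A z) i) z₀ := by
  simp only [mulVec, dotProduct, Fin.sum_univ_two]
  exact ((hM i 0).mul (hA 0)).add ((hM i 1).mul (hA 1))

lemma analyticAt_det (hM : ∀ i j, AnalyticAt ℂ (fun z => M z i j) z₀) :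
    AnalyticAt ℂ (fun z => (M z).det) z₀ := by
  simp only [det_fin_two]
  exact ((hM 0 0).mul (hM 1 1)).sub ((hM 0 1).mul (hM 1 0))

lemma analyticAt_adjugate (hM : ∀ i j, AnalyticAt ℂ (fun z => M z i j) z₀) (i j : Fin 2) :
    AnalyticAt ℂ (fun z => (M z).adjugate i j) z₀ := by
  simp only [adjugate_fin_two]
  fin_cases i <;> fin_cases j
  · exact hM 1 1
  · exact (hM 0 1).neg
  · exact (hM 1 0).neg
  · exact hM 0 0

/-- A vector function which solves one nontrivial equation of a linear system solves the other one
up to the order of the zero of the determinant. -/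
lemma isBigO_mulVec (hM : ∀ i j, AnalyticAt ℂ (fun z => M z i j) z₀)
    (hA : ∀ j, AnalyticAt ℂ (fun z => A z j) z₀)
    (hdet : (fun z => (M z).det) =O[𝓝 z₀] fun z => (z - z₀) ^ n) {i : Fin 2} (hi : M z₀ i ≠ 0)
    (h : ∀ᶠ z in 𝓝 z₀, (M z *ᵥ A z) i = 0) :
    (fun z => M z *ᵥ A z) =O[𝓝 z₀] fun z => (z - z₀) ^ n := by
  rw [Asymptotics.isBigO_pi]
  intro j
  by_cases hij : j = i
  · subst hij
    exact EventuallyEq.trans_isBigO (f₂ := fun _ => (0 : ℂ)) h (Asymptotics.isBigO_zero _ _)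
  obtain ⟨k, hk⟩ : ∃ k, M z₀ i k ≠ 0 := by
    by_contra hk
    push Not at hk
    exact hi (funext hk)
  -- Cramer's rule: eliminating the k-th unknown between the two rows leaves ± the determinant times
  -- the other unknown.
  obtain ⟨k', ε, hε⟩ : ∃ (k' : Fin 2) (ε : ℂ), ∀ z, M z i k * (M z *ᵥ A z) j
      = ε * ((M z).det * A z k') + M z j k * (M z *ᵥ A z) i := by
    simp only [mulVec, dotProduct, Fin.sum_univ_two, det_fin_two]
    fin_cases i <;> fin_cases j <;> fin_cases k <;>
      simp only [Fin.zero_eta, Fin.mk_one, not_true_eq_false] at hij ⊢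
    · exact ⟨1, 1, fun z => by ring⟩
    · exact ⟨0, -1, fun z => by ring⟩
    · exact ⟨1, -1, fun z => by ring⟩
    · exact ⟨0, 1, fun z => by ring⟩
  have hinv : (fun z => (M z i k)⁻¹ * (ε * A z k')) =O[𝓝 z₀] fun _ => (1 : ℂ) :=
    (((hM i k).continuousAt.inv₀ hk).mul
      (continuousAt_const.mul (hA k').continuousAt)).isBigO_one ℂ
  have := hdet.mul hinv
  simp only [mul_one] at this
  refine EventuallyEq.trans_isBigO ?_ this
  filter_upwards [h, (hM i k).continuousAt.eventually_ne hk] with z h1 h2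
  have h3 := hε z
  rw [h1, mul_zero, add_zero] at h3
  field_simp
  linear_combination h3

/-- If the determinant has a zero of order exactly `n`, no vector function that does not vanish
at `z₀` can be corrected to solve the linear system to the order `n + 1`. -/
lemma eq_zero_of_mulVec_order (hM : ∀ i j, AnalyticAt ℂ (fun z => M z i j) z₀)
    (hA : ∀ j, AnalyticAt ℂ (fun z => A z j) z₀)
    (hdet : ∀ l < n, iteratedDeriv l (fun z => (M z).det) z₀ = 0)
    (hdet' : iteratedDeriv n (fun z => (M z).det) z₀ ≠ 0) (hn : 0 < n)
    (h : ∀ i, ∀ l < n, iteratedDeriv l (fun z => (M z *ᵥ A z) i) z₀ = 0) {B : Fin 2 → ℂ} {r : ℂ}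
    (hB : ∀ i, iteratedDeriv n (fun z => (M z *ᵥ A z) i) z₀ + r * (M z₀ *ᵥ B) i = 0) :
    A z₀ = 0 := by
  ext j
  -- The identity adj(M)(MA) = det(M)A, to be differentiated n times at z₀.
  have e : (fun z => (M z).det * A z j) = fun z => (M z *ᵥ A z) 0 * (M z).adjugate j 0
      + (M z *ᵥ A z) 1 * (M z).adjugate j 1 := by
    funext z
    have := congrFun (congrArg (fun N => N *ᵥ A z) (adjugate_mul (M z))) j
    rw [← mulVec_mulVec, smul_mulVec, one_mulVec] at this
    simp only [Pi.smul_apply, smul_eq_mul] at this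
    rw [← this, mulVec, dotProduct, Fin.sum_univ_two]
    ring
  have h0 : (M z₀).det = 0 := by simpa using hdet 0 hn
  have e1 := congrArg (fun f => iteratedDeriv n f z₀) e
  have hMA := analyticAt_mulVec hM hA
  have hadj := analyticAt_adjugate hM
  have hm : ∀ i, AnalyticAt ℂ (fun z => (M z *ᵥ A z) i * (M z).adjugate j i) z₀ :=
    fun i => (hMA i).mul (hadj j i)
  rw [iteratedDeriv_mul_of_eq_zero (analyticAt_det hM) (hA j) hdet,
    iteratedDeriv_fun_add (hm 0).contDiffAt (hm 1).contDiffAt,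
    iteratedDeriv_mul_of_eq_zero (hMA 0) (hadj j 0) (h 0),
    iteratedDeriv_mul_of_eq_zero (hMA 1) (hadj j 1) (h 1),
    eq_neg_of_add_eq_zero_left (hB 0), eq_neg_of_add_eq_zero_left (hB 1)] at e1
  have e2 := congrFun (congrArg (fun N => N *ᵥ B) (adjugate_mul (M z₀))) j
  rw [← mulVec_mulVec, h0, zero_smul, zero_mulVec, mulVec, dotProduct, Fin.sum_univ_two] at e2
  simp only [Pi.zero_apply] at e2
  -- The n-th derivatives of MA were replaced by -rM(z₀)B, which the adjugate sends to -r
  -- det(M(z₀))B = 0.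
  have : iteratedDeriv n (fun z => (M z).det) z₀ * A z₀ j = 0 := by
    linear_combination e1 - r * e2
  exact (mul_eq_zero.1 this).resolve_left hdet'

end Matrix2

/-! ### Parameter derivatives of the two pieces of the ansatz -/

/-- The `n`-th derivative of `z ↦ α(z) v(z,x)` with respect to the parameter `z`. -/
def pieceJet (α : ℂ → ℂ) (v : ℂ → ℝ → ℂ) (z : ℂ) (n : ℕ) (x : ℝ) : ℂ :=
  iteratedDeriv n (fun z => α z * v z x) z

section PieceJet

variable {α S C s : ℂ → ℂ} {v : ℂ → ℝ → ℂ} {z d : ℂ}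

lemma hasDerivAt_of_wave (hv : ∀ z x, v z x = wave S C s z x) (z : ℂ) (x : ℝ) :
    HasDerivAt (v z) (wave (fun z => -(C z * s z)) (fun z => S z * s z) s z x) x := by
  rw [show v z = fun x : ℝ => wave S C s z x from funext (hv z)]
  exact (hasDerivAt_wave S C s z x).comp_ofReal

/-- An amplitude depending only on the parameter is absorbed into the coefficients, so the facts on
jets apply to αv. -/
lemma mul_wave (α S C s : ℂ → ℂ) (z ξ : ℂ) :
    α z * wave S C s z ξ = wave (fun z => α z * S z) (fun z => α z * C z) s z ξ := by
  simp only [wave]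
  ring

lemma pieceJet_eq_jet (hv : ∀ z x, v z x = wave S C s z x) :
    pieceJet α v z = jet (fun z => α z * S z) (fun z => α z * C z) s z := by
  funext n x
  simp only [pieceJet, jet, hv, mul_wave]

lemma pieceJet_deriv_eq_jet (hv : ∀ z x, v z x = wave S C s z x) :
    pieceJet α (fun z => deriv (v z)) z
      = jet (fun z => -((α z * C z) * s z)) (fun z => (α z * S z) * s z) s z := by
  funext n x
  simp only [pieceJet, jet, (hasDerivAt_of_wave hv _ _).deriv, mul_wave]
  congr 1
  funext z
  simp only [wave]
  ring

lemma hasDerivAt_pieceJet (hα : AnalyticAt ℂ α z) (hS : AnalyticAt ℂ S z)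
    (hC : AnalyticAt ℂ C z) (hs : AnalyticAt ℂ s z) (hv : ∀ z x, v z x = wave S C s z x)
    (n : ℕ) (x : ℝ) :
    HasDerivAt (pieceJet α v z n) (pieceJet α (fun z => deriv (v z)) z n x) x := by
  rw [pieceJet_eq_jet hv, pieceJet_deriv_eq_jet hv]
  exact hasDerivAt_jet (hα.mul hS) (hα.mul hC) hs n x

lemma hasDerivAt_pieceJet_deriv (hα : AnalyticAt ℂ α z) (hS : AnalyticAt ℂ S z)
    (hC : AnalyticAt ℂ C z) (hs : AnalyticAt ℂ s z) (hv : ∀ z x, v z x = wave S C s z x)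
    (hd : ∀ᶠ z in 𝓝 z, s z ^ 2 = z / d) (n : ℕ) (x : ℝ) :
    HasDerivAt (pieceJet α (fun z => deriv (v z)) z n)
      (-(z * pieceJet α v z n x + n * pieceJet α v z (n - 1) x) / d) x := by
  rw [pieceJet_eq_jet hv, pieceJet_deriv_eq_jet hv]
  exact hasDerivAt_jet_deriv (hα.mul hS) (hα.mul hC) hs hd n x

lemma analyticAt_of_wave (hS : AnalyticAt ℂ S z) (hC : AnalyticAt ℂ C z) (hs : AnalyticAt ℂ s z)
    (hv : ∀ z x, v z x = wave S C s z x) (x : ℝ) : AnalyticAt ℂ (fun z => v z x) z := by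
  simp only [hv]
  exact analyticAt_wave_left hS hC hs x

lemma analyticAt_deriv_of_wave (hS : AnalyticAt ℂ S z) (hC : AnalyticAt ℂ C z)
    (hs : AnalyticAt ℂ s z) (hv : ∀ z x, v z x = wave S C s z x) (x : ℝ) :
    AnalyticAt ℂ (fun z => deriv (v z) x) z := by
  simp only [(hasDerivAt_of_wave hv _ _).deriv]
  exact analyticAt_wave_left (hC.mul hs).neg (hS.mul hs) hs x

end PieceJet

lemma vL_eq_wave (s : ℂ → ℂ) (z : ℂ) (x : ℝ) :
    vL (s z) x = wave (fun _ => 1) (fun _ => 0) s z x := by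
  simp [vL, wave]

lemma vR_eq_wave (aR c : ℂ) (s : ℂ → ℂ) (z : ℂ) (x : ℝ) : vR aR c (s z) x
    = wave (fun z => aR * s z * Complex.sin (s z) - c * Complex.cos (s z))
      (fun z => aR * s z * Complex.cos (s z) + c * Complex.sin (s z)) s z x := rfl

/-! ### The transmission matrix and its kernel -/

section Branches

open Matrix

variable {aR : ℂ} {b : ℝ} {c lam : ℂ} {muL muR : ℂ → ℂ} {A : ℂ → Fin 2 → ℂ}

lemma analyticAt_coeff_sin {s : ℂ → ℂ} (hs : AnalyticAt ℂ s lam) (aR c : ℂ) :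
    AnalyticAt ℂ (fun z => aR * s z * Complex.sin (s z) - c * Complex.cos (s z)) lam :=
  ((analyticAt_const.mul hs).mul (Complex.analyticAt_sin.comp hs)).sub
    (analyticAt_const.mul (Complex.analyticAt_cos.comp hs))

lemma analyticAt_coeff_cos {s : ℂ → ℂ} (hs : AnalyticAt ℂ s lam) (aR c : ℂ) :
    AnalyticAt ℂ (fun z => aR * s z * Complex.cos (s z) + c * Complex.sin (s z)) lam :=
  ((analyticAt_const.mul hs).mul (Complex.analyticAt_cos.comp hs)).add
    (analyticAt_const.mul (Complex.analyticAt_sin.comp hs))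

lemma analyticAt_matM (hL : AnalyticAt ℂ muL lam) (hR : AnalyticAt ℂ muR lam) (i j : Fin 2) :
    AnalyticAt ℂ (fun z => matM aR b c (muL z) (muR z) i j) lam := by
  have h1 := analyticAt_coeff_sin hR aR c
  have h2 := analyticAt_coeff_cos hR aR c
  fin_cases i <;> fin_cases j
  · exact analyticAt_of_wave analyticAt_const analyticAt_const hL (vL_eq_wave muL) b
  · exact (analyticAt_of_wave h1 h2 hR (vR_eq_wave aR c muR) b).neg
  · exact analyticAt_deriv_of_wave (v := fun z => vL (muL z)) analyticAt_const analyticAt_const hL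
      (vL_eq_wave muL) b
  · exact (analyticAt_const.mul (analyticAt_deriv_of_wave (v := fun z => vR aR c (muR z))
      h1 h2 hR (vR_eq_wave aR c muR) b)).neg

lemma matM_mulVec_zero (mL mR : ℂ) (B : Fin 2 → ℂ) : (matM aR b c mL mR *ᵥ B) 0
    = B 0 * vL mL b - B 1 * vR aR c mR b := by
  simp only [matM, mulVec, dotProduct, Fin.sum_univ_two, of_apply, cons_val_zero, cons_val_one]
  ring

lemma matM_mulVec_one (mL mR : ℂ) (B : Fin 2 → ℂ) : (matM aR b c mL mR *ᵥ B) 1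
    = B 0 * deriv (vL mL) b - aR * (B 1 * deriv (vR aR c mR) b) := by
  simp only [matM, mulVec, dotProduct, Fin.sum_univ_two, of_apply, cons_val_zero, cons_val_one]
  ring

/-- The first column is (sin m_L b, m_L cos m_L b), which cannot vanish when m_L ≠ 0, as sin² + cos²
= 1. -/
lemma matM_ne_zero {mL : ℂ} (hmL : mL ≠ 0) (mR : ℂ) : ∃ i, matM aR b c mL mR i ≠ 0 := by
  by_contra h
  push Not at h
  have h0 : vL mL b = 0 := congrFun (h 0) 0
  have h1 : deriv (vL mL) b = 0 := congrFun (h 1) 0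
  rw [(hasDerivAt_vL mL b).deriv] at h1
  rw [vL] at h0
  have := Complex.sin_sq_add_cos_sq (mL * b)
  rw [h0, (mul_eq_zero.1 h1).resolve_left hmL] at this
  simp at this

lemma extR_add_smul (u v : V) (k l : ℂ) (x : ℝ) :
    extR (k • u + l • v).1 x = k * extR u.1 x + l * extR v.1 x := rfl

/-- Eigenfunctions are given by the kernel of `M`. -/
lemma exists_kernel_of_eigen (haR : aR ≠ 0) (hb : b ∈ Ioo (0 : ℝ) 1) {mL mR : ℂ} (hlam : lam ≠ 0)
    (hmL : mL ^ 2 = lam) (hmR : mR ^ 2 = lam / aR) {w : V}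
    (hw : opA aR b c w = opI (lam • w)) : ∃ B : Fin 2 → ℂ,
      (∀ x : unitInterval, w.1 x = ansatz aR b c mL mR B x) ∧ matM aR b c mL mR *ᵥ B = 0 := by
  have hx : ∀ x, extR (lam • w).1 x = lam * extR w.1 x := fun x => rfl
  obtain ⟨B, h1, h2, h3, h4⟩ := exists_combination (p := fun _ => 0) (p' := fun _ => 0)
    (q := fun _ => 0) (q' := fun _ => 0) haR hb hlam hmL hmR hw
    (fun x => hasDerivAt_const x 0) (fun x => hasDerivAt_const x 0) rfl (by simp)
    (fun x _ => (hasDerivAt_const x 0).congr_deriv (by rw [hx]; ring))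
    (fun x _ => (hasDerivAt_const x 0).congr_deriv (by rw [hx]; ring))
  refine ⟨B, fun x => ?_, ?_⟩
  · rw [← extR_eq, ansatz]
    split_ifs with h
    · rw [h1 x ⟨x.2.1, h⟩, zero_add]
    · rw [h2 x ⟨(not_le.1 h).le, x.2.2⟩, zero_add]
  · ext i
    fin_cases i
    · refine (matM_mulVec_zero mL mR B).trans ?_
      simp only [zero_add, Pi.zero_apply] at h3 ⊢
      rw [h3, sub_self]
    · refine (matM_mulVec_one mL mR B).trans ?_
      simp only [zero_add, Pi.zero_apply] at h4 ⊢
      rw [h4, sub_self]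

/-- The eigenspaces are one-dimensional. -/
lemma exists_smul_of_eigen (haR : aR ≠ 0) (hb : b ∈ Ioo (0 : ℝ) 1) {mL mR : ℂ} (hlam : lam ≠ 0)
    (hmL : mL ^ 2 = lam) (hmR : mR ^ 2 = lam / aR) {u w : V} (hu0 : u ≠ 0)
    (hu : opA aR b c u = opI (lam • u)) (hw : opA aR b c w = opI (lam • w)) :
    ∃ k : ℂ, w = k • u := by
  obtain ⟨B, h1, h2⟩ := exists_kernel_of_eigen haR hb hlam hmL hmR hu
  obtain ⟨B', h1', h2'⟩ := exists_kernel_of_eigen haR hb hlam hmL hmR hw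
  have hmL0 : mL ≠ 0 := by rintro rfl; exact hlam (by rw [← hmL]; simp)
  -- Both coefficient vectors annihilate the same nonzero row, hence are proportional.
  obtain ⟨i, hi⟩ := matM_ne_zero (aR := aR) (b := b) (c := c) hmL0 mR
  have hrow : ∀ B, matM aR b c mL mR *ᵥ B = 0 →
      matM aR b c mL mR i 0 * B 0 + matM aR b c mL mR i 1 * B 1 = 0 := by
    intro B hB
    have := congrFun hB i
    rwa [mulVec, dotProduct, Fin.sum_univ_two] at this
  obtain ⟨t, ht0, ht1⟩ := exists_smul_of_row hi (hrow B h2)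
  obtain ⟨t', ht0', ht1'⟩ := exists_smul_of_row hi (hrow B' h2')
  have ht : t ≠ 0 := by
    rintro rfl
    refine hu0 (V_ext fun x => ?_)
    rw [h1 x, ansatz, ht0, ht1]
    simp
  refine ⟨t' / t, V_ext fun x => ?_⟩
  change w.1 x = t' / t * u.1 x
  rw [h1 x, h1' x, ansatz, ansatz, ht0, ht1, ht0', ht1']
  split_ifs <;> field_simp

lemma pieceJet_left_zero (α : ℂ → ℂ) (n : ℕ) :
    pieceJet α (fun z => vL (muL z)) lam n 0 = 0 := by
  simp [pieceJet, vL]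

/-- The Robin condition for v^R holds for every parameter value, so differentiation preserves it. -/
lemma pieceJet_robin (hR : IsSqrtBranch muR aR lam) {α : ℂ → ℂ} (hα : AnalyticAt ℂ α lam)
    (n : ℕ) : aR * pieceJet α (fun z => deriv (vR aR c (muR z))) lam n 1
      + c * pieceJet α (fun z => vR aR c (muR z)) lam n 1 = 0 := by
  have h1 := analyticAt_coeff_sin hR.1 aR c
  have h2 := analyticAt_coeff_cos hR.1 aR c
  have a1 : AnalyticAt ℂ (fun z => aR * (α z * deriv (vR aR c (muR z)) 1)) lam :=
    analyticAt_const.mul (hα.mul (analyticAt_deriv_of_wave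
    (v := fun z => vR aR c (muR z)) h1 h2 hR.1 (vR_eq_wave aR c muR) 1))
  have a2 : AnalyticAt ℂ (fun z => c * (α z * vR aR c (muR z) 1)) lam :=
    analyticAt_const.mul (hα.mul (analyticAt_of_wave h1 h2 hR.1
    (vR_eq_wave aR c muR) 1))
  rw [pieceJet, pieceJet, ← iteratedDeriv_const_mul_field, ← iteratedDeriv_const_mul_field,
    ← iteratedDeriv_fun_add a1.contDiffAt a2.contDiffAt]
  have : (fun z => aR * (α z * deriv (vR aR c (muR z)) 1) + c * (α z * vR aR c (muR z) 1))
      = fun _ => 0 := by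
    funext z
    linear_combination α z * vR_robin aR c (muR z)
  rw [this]
  simp

/-- The transmission defect of the n-th parameter derivative of the ansatz is the n-th derivative of
MA; this row concerns values, the next one fluxes. -/
lemma iteratedDeriv_row_zero (hL : IsSqrtBranch muL 1 lam) (hR : IsSqrtBranch muR aR lam)
    (hA : ∀ j, AnalyticAt ℂ (fun z => A z j) lam) (n : ℕ) :
    iteratedDeriv n (fun z => (matM aR b c (muL z) (muR z) *ᵥ A z) 0) lam
      = pieceJet (fun z => A z 0) (fun z => vL (muL z)) lam n b
        - pieceJet (fun z => A z 1) (fun z => vR aR c (muR z)) lam n b := by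
  have a1 : AnalyticAt ℂ (fun z => A z 0 * vL (muL z) b) lam :=
    (hA 0).mul (analyticAt_of_wave analyticAt_const analyticAt_const hL.1
    (vL_eq_wave muL) b)
  have a2 : AnalyticAt ℂ (fun z => A z 1 * vR aR c (muR z) b) lam :=
    (hA 1).mul (analyticAt_of_wave (analyticAt_coeff_sin hR.1 aR c)
    (analyticAt_coeff_cos hR.1 aR c) hR.1 (vR_eq_wave aR c muR) b)
  rw [pieceJet, pieceJet, ← iteratedDeriv_fun_sub a1.contDiffAt a2.contDiffAt]
  simp only [matM_mulVec_zero]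

lemma iteratedDeriv_row_one (hL : IsSqrtBranch muL 1 lam) (hR : IsSqrtBranch muR aR lam)
    (hA : ∀ j, AnalyticAt ℂ (fun z => A z j) lam) (n : ℕ) :
    iteratedDeriv n (fun z => (matM aR b c (muL z) (muR z) *ᵥ A z) 1) lam
      = pieceJet (fun z => A z 0) (fun z => deriv (vL (muL z))) lam n b
        - aR * pieceJet (fun z => A z 1) (fun z => deriv (vR aR c (muR z))) lam n b := by
  have a1 : AnalyticAt ℂ (fun z => A z 0 * deriv (vL (muL z)) b) lam :=
    (hA 0).mul (analyticAt_deriv_of_wave (v := fun z => vL (muL z)) analyticAt_const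
    analyticAt_const hL.1 (vL_eq_wave muL) b)
  have a2 : AnalyticAt ℂ (fun z => aR * (A z 1 * deriv (vR aR c (muR z)) b)) lam :=
    analyticAt_const.mul ((hA 1).mul (analyticAt_deriv_of_wave
    (v := fun z => vR aR c (muR z)) (analyticAt_coeff_sin hR.1 aR c)
    (analyticAt_coeff_cos hR.1 aR c) hR.1 (vR_eq_wave aR c muR) b))
  rw [pieceJet, pieceJet, ← iteratedDeriv_const_mul_field,
    ← iteratedDeriv_fun_sub a1.contDiffAt a2.contDiffAt]
  simp only [matM_mulVec_one]

end Branches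

/-! ### The chain of parameter derivatives and its maximality -/

section Chain

open Matrix

variable {aR : ℂ} {b : ℝ} {c lam : ℂ} {muL muR : ℂ → ℂ} {A : ℂ → Fin 2 → ℂ} {ν : ℕ}

lemma sqrtBranch_sq {s : ℂ → ℂ} {d : ℂ} (hs : IsSqrtBranch s d lam) : s lam ^ 2 = lam / d :=
  hs.2.self_of_nhds

/-- The derivatives of the ansatz with respect to the spectral parameter form a chain of weak
solutions. -/
lemma exists_chain (haR : aR ≠ 0) (hb : b ∈ Ioo (0 : ℝ) 1) (hL : IsSqrtBranch muL 1 lam)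
    (hR : IsSqrtBranch muR aR lam) (hA : ∀ j, AnalyticAt ℂ (fun z => A z j) lam)
    (h : ∀ i, ∀ l < ν, iteratedDeriv l (fun z => (matM aR b c (muL z) (muR z) *ᵥ A z) i) lam = 0) :
    ∃ y : ℕ → V, (∀ n < ν, ∀ x ∈ Icc 0 b, extR (y n).1 x
        = pieceJet (fun z => A z 0) (fun z => vL (muL z)) lam n x) ∧
      (∀ n < ν, ∀ x ∈ Icc b 1, extR (y n).1 x
        = pieceJet (fun z => A z 1) (fun z => vR aR c (muR z)) lam n x) ∧
      ∀ n < ν, opA aR b c (y n) = opI ((n : ℂ) • y (n - 1) + lam • y n) := by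
  have dp := hasDerivAt_pieceJet (v := fun z => vL (muL z)) (hA 0) analyticAt_const
    analyticAt_const hL.1 (vL_eq_wave muL)
  have dp' := hasDerivAt_pieceJet_deriv (v := fun z => vL (muL z)) (hA 0) analyticAt_const
    analyticAt_const hL.1 (vL_eq_wave muL) hL.2
  have dq := hasDerivAt_pieceJet (v := fun z => vR aR c (muR z)) (hA 1)
    (analyticAt_coeff_sin hR.1 aR c) (analyticAt_coeff_cos hR.1 aR c) hR.1
    (vR_eq_wave aR c muR)
  have dq' := hasDerivAt_pieceJet_deriv (v := fun z => vR aR c (muR z)) (hA 1)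
    (analyticAt_coeff_sin hR.1 aR c) (analyticAt_coeff_cos hR.1 aR c) hR.1
    (vR_eq_wave aR c muR) hR.2
  have hrow0 := iteratedDeriv_row_zero (b := b) (c := c) hL hR hA
  have hrow1 := iteratedDeriv_row_one (b := b) (c := c) hL hR hA
  have hrobin := pieceJet_robin (c := c) hR (hA 1)
  -- The condition n < ν is placed inside the existential to obtain a total sequence; members from
  -- index ν on are arbitrary.
  have hex : ∀ n, ∃ w : V, n < ν →
      (∀ x ∈ Icc 0 b, extR w.1 x
        = pieceJet (fun z => A z 0) (fun z => vL (muL z)) lam n x) ∧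
      (∀ x ∈ Icc b 1, extR w.1 x
        = pieceJet (fun z => A z 1) (fun z => vR aR c (muR z)) lam n x) ∧
      ∀ᵐ x ∂mu, D w x = if x < b
        then pieceJet (fun z => A z 0) (fun z => deriv (vL (muL z))) lam n x
        else pieceJet (fun z => A z 1) (fun z => deriv (vR aR c (muR z))) lam n x := by
    intro n
    by_cases hn : n < ν
    · obtain ⟨w, hw⟩ := exists_V_of_pieces hb (dp n) (dq n)
        (continuous_iff_continuousAt.2 fun x => (dp' n x).continuousAt)
        (continuous_iff_continuousAt.2 fun x => (dq' n x).continuousAt)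
        (pieceJet_left_zero _ n) (by
          rw [← sub_eq_zero, ← hrow0 n]
          exact h 0 n hn)
      exact ⟨w, fun _ => hw⟩
    · exact ⟨0, fun hn' => absurd hn' hn⟩
  choose y hy using hex
  refine ⟨y, fun n hn => (hy n hn).1, fun n hn => (hy n hn).2.1, fun n hn => ?_⟩
  -- At n = 0 the truncated predecessor is y 0 itself, but it enters with coefficient 0.
  have hn' : n - 1 < ν := by omega
  refine opA_eq_opI_of_pieces haR hb (hy n hn).2.2 (fun x hx => ?_) (fun x hx => ?_) ?_ ?_
  · refine (dp' n x).congr_deriv ?_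
    rw [extR_add_smul, (hy n hn).1 x hx, (hy (n - 1) hn').1 x hx]
    ring
  · refine (dq' n x).congr_deriv ?_
    rw [extR_add_smul, (hy n hn).2.1 x hx, (hy (n - 1) hn').2.1 x hx]
    ring
  · rw [← sub_eq_zero, ← hrow1 n]
    exact h 1 n hn
  · rw [← hrobin n]
    congr 2
    rw [← (hy n hn).2.1 1 ⟨hb.2.le, le_rfl⟩]
    exact (extR_eq (y n).1 1).symm

/-- The chain of derivatives cannot be continued beyond the order of the zero of `det M`. -/
lemma not_exists_continuation (haR : aR ≠ 0) (hb : b ∈ Ioo (0 : ℝ) 1) (hlam : lam ≠ 0)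
    (hL : IsSqrtBranch muL 1 lam) (hR : IsSqrtBranch muR aR lam)
    (hA : ∀ j, AnalyticAt ℂ (fun z => A z j) lam) (hA0 : A lam ≠ 0)
    (h : ∀ i, ∀ l < ν, iteratedDeriv l (fun z => (matM aR b c (muL z) (muR z) *ᵥ A z) i) lam = 0)
    (hdet : ∀ l < ν, iteratedDeriv l (fun z => (matM aR b c (muL z) (muR z)).det) lam = 0)
    (hdet' : iteratedDeriv ν (fun z => (matM aR b c (muL z) (muR z)).det) lam ≠ 0)
    (hν : 0 < ν) {y w : V}
    (hyL : ∀ x ∈ Icc 0 b, extR y.1 x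
        = pieceJet (fun z => A z 0) (fun z => vL (muL z)) lam (ν - 1) x)
    (hyR : ∀ x ∈ Icc b 1, extR y.1 x
        = pieceJet (fun z => A z 1) (fun z => vR aR c (muR z)) lam (ν - 1) x) :
    opA aR b c w ≠ opI (y + lam • w) := by
  intro hw
  have dp := hasDerivAt_pieceJet (v := fun z => vL (muL z)) (hA 0) analyticAt_const
    analyticAt_const hL.1 (vL_eq_wave muL)
  have dp' := hasDerivAt_pieceJet_deriv (v := fun z => vL (muL z)) (hA 0) analyticAt_const
    analyticAt_const hL.1 (vL_eq_wave muL) hL.2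
  have dq := hasDerivAt_pieceJet (v := fun z => vR aR c (muR z)) (hA 1)
    (analyticAt_coeff_sin hR.1 aR c) (analyticAt_coeff_cos hR.1 aR c) hR.1
    (vR_eq_wave aR c muR)
  have dq' := hasDerivAt_pieceJet_deriv (v := fun z => vR aR c (muR z)) (hA 1)
    (analyticAt_coeff_sin hR.1 aR c) (analyticAt_coeff_cos hR.1 aR c) hR.1
    (vR_eq_wave aR c muR) hR.2
  have hν0 : (ν : ℂ) ≠ 0 := by exact_mod_cast hν.ne'
  have hx : ∀ x, extR (y + lam • w).1 x = extR y.1 x + lam * extR w.1 x := fun x => rfl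
  have hmL : muL lam ^ 2 = lam := by simpa using sqrtBranch_sq hL
  -- The particular solution is the ν-th derivative of the ansatz divided by ν: the equation of that
  -- derivative has source ν times the derivative of order ν - 1.
  obtain ⟨B, -, -, h3, h4⟩ := exists_combination haR hb hlam hmL (sqrtBranch_sq hR) hw
    (fun x => (dp ν x).const_mul (ν : ℂ)⁻¹) (fun x => (dq ν x).const_mul (ν : ℂ)⁻¹)
    (by rw [pieceJet_left_zero, mul_zero])
    (by linear_combination (ν : ℂ)⁻¹ * pieceJet_robin (c := c) hR (hA 1) ν)
    (fun x hx' => ((dp' ν x).const_mul (ν : ℂ)⁻¹).congr_deriv (by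
      rw [hx, hyL x hx']
      field_simp
      ring))
    (fun x hx' => ((dq' ν x).const_mul (ν : ℂ)⁻¹).congr_deriv (by
      rw [hx, hyR x hx']
      field_simp
      ring))
  -- The value r = ν comes from clearing the factor 1/ν in the transmission conditions of w.
  refine hA0 (eq_zero_of_mulVec_order (analyticAt_matM hL.1 hR.1) hA hdet hdet' hν h (B := B)
    (r := ν) fun i => ?_)
  fin_cases i
  · simp only [Fin.zero_eta]
    rw [iteratedDeriv_row_zero hL hR hA, matM_mulVec_zero]
    field_simp at h3
    linear_combination h3
  · simp only [Fin.mk_one]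
    rw [iteratedDeriv_row_one hL hR hA, matM_mulVec_one]
    field_simp at h4
    linear_combination h4

lemma analyticAt_apply {u : V} (hA : Extends aR b c muL muR lam u A) (j : Fin 2) :
    AnalyticAt ℂ (fun z => A z j) lam := (analyticAt_pi_iff.1 hA.1) j

lemma iteratedDeriv_mulVec_eq_zero (hL : IsSqrtBranch muL 1 lam) (hR : IsSqrtBranch muR aR lam)
    (hA : ∀ j, AnalyticAt ℂ (fun z => A z j) lam) (h : SolvesToOrder aR b c muL muR lam A ν)
    (i : Fin 2) : ∀ l < ν,
    iteratedDeriv l (fun z => (matM aR b c (muL z) (muR z) *ᵥ A z) i) lam = 0 :=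
  (isBigO_pow_iff (analyticAt_mulVec (analyticAt_matM hL.1 hR.1) hA i)).1
    (Asymptotics.isBigO_pi.1 h i)

/-- The derivatives of the ansatz form a maximal chain of generalized eigenfunctions. -/
lemma exists_isMaximalChain (haR : aR ≠ 0) (hb : b ∈ Ioo (0 : ℝ) 1) (hlam : lam ≠ 0)
    (hL : IsSqrtBranch muL 1 lam) (hR : IsSqrtBranch muR aR lam) {u : V} (hu0 : u ≠ 0)
    (hu : opA aR b c u = opI (lam • u))
    (hdet : ∀ l < ν, iteratedDeriv l (fun z => (matM aR b c (muL z) (muR z)).det) lam = 0)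
    (hdet' : iteratedDeriv ν (fun z => (matM aR b c (muL z) (muR z)).det) lam ≠ 0)
    (hν : 0 < ν) (hA : Extends aR b c muL muR lam u A)
    (h : SolvesToOrder aR b c muL muR lam A ν) :
    ∃ y : ℕ → V, IsMaximalChain aR b c lam ν y ∧ ∀ n < ν, ∀ x : unitInterval,
      (y n).1 x = iteratedDeriv n (fun z => ansatz aR b c (muL z) (muR z) (A z) x) lam := by
  have hAj := analyticAt_apply hA
  have h0 := iteratedDeriv_mulVec_eq_zero hL hR hAj h
  obtain ⟨y, hyL, hyR, hy⟩ := exists_chain haR hb hL hR hAj h0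
  have hval : ∀ n < ν, ∀ x : unitInterval,
      (y n).1 x = iteratedDeriv n (fun z => ansatz aR b c (muL z) (muR z) (A z) x) lam := by
    intro n hn x
    rw [← extR_eq]
    simp only [ansatz]
    split_ifs with hx
    · exact hyL n hn x ⟨x.2.1, hx⟩
    · exact hyR n hn x ⟨(not_le.1 hx).le, x.2.2⟩
  have hy0 : y 0 = u := V_ext fun x => by
    rw [hval 0 hν x, hA.2 x, iteratedDeriv_zero]
  have hA0 : A lam ≠ 0 := by
    intro hz
    refine hu0 (V_ext fun x => ?_)
    rw [hA.2 x, ansatz, hz]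
    simp
  have hmL : muL lam ^ 2 = lam := by simpa using sqrtBranch_sq hL
  refine ⟨y, ⟨hν, by rwa [hy0], by rwa [hy0], fun n hn => by simpa using hy (n + 1) hn,
    fun w hw => ?_, fun w => ?_⟩, hval⟩
  · rw [hy0]
    exact exists_smul_of_eigen haR hb hlam hmL (sqrtBranch_sq hR) hu0 hu hw
  · exact not_exists_continuation haR hb hlam hL hR hAj hA0 h0 hdet hdet' hν
      (hyL (ν - 1) (by omega)) (hyR (ν - 1) (by omega))

/-- An eigenfunction extends analytically in the spectral parameter, so that one of the
transmission equations is satisfied. -/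
lemma exists_extends_solvesRow (haR : aR ≠ 0) (hb : b ∈ Ioo (0 : ℝ) 1) (hlam : lam ≠ 0)
    (hL : IsSqrtBranch muL 1 lam) (hR : IsSqrtBranch muR aR lam) {u : V}
    (hu : opA aR b c u = opI (lam • u)) : ∃ (A : ℂ → Fin 2 → ℂ) (i : Fin 2),
      Extends aR b c muL muR lam u A ∧ SolvesRow aR b c muL muR lam A i := by
  have hmL : muL lam ^ 2 = lam := by simpa using sqrtBranch_sq hL
  have hmL0 : muL lam ≠ 0 := by
    intro h
    rw [h] at hmL
    exact hlam (by rw [← hmL]; simp)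
  obtain ⟨B, hB, hB0⟩ := exists_kernel_of_eigen haR hb hlam hmL (sqrtBranch_sq hR) hu
  obtain ⟨i, hi⟩ := matM_ne_zero (aR := aR) (b := b) (c := c) hmL0 (muR lam)
  have hrow := congrFun hB0 i
  rw [mulVec, dotProduct, Fin.sum_univ_two] at hrow
  obtain ⟨t, ht0, ht1⟩ := exists_smul_of_row hi hrow
  have hM := analyticAt_matM (aR := aR) (b := b) (c := c) hL.1 hR.1 i
  -- Letting the row vary with z in (r₁, -r₀) solves the i-th equation identically and is analytic;
  -- the constant t matches the eigenfunction at λ_j.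
  refine ⟨fun z => ![t * matM aR b c (muL z) (muR z) i 1, -(t * matM aR b c (muL z) (muR z) i 0)],
    i, ⟨?_, fun x => ?_⟩, hi, Eventually.of_forall fun z => ?_⟩
  · rw [analyticAt_pi_iff]
    intro j
    fin_cases j
    · exact analyticAt_const.mul (hM 1)
    · exact (analyticAt_const.mul (hM 0)).neg
  · rw [hB x, ansatz, ansatz, ht0, ht1]
    rfl
  · rw [mulVec, dotProduct, Fin.sum_univ_two]
    simp only [cons_val_zero, cons_val_one]
    ring

end Chain

end

end Transmission

/-! ### The main theorem -/

theorem mainTheorem1 (aR : ℂ) (haR : 0 < aR.re) (b : ℝ) (hb : b ∈ Set.Ioo (0 : ℝ) 1) (c : ℂ)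
    (uj : Transmission.V) (lamj : ℂ) (hlamj : lamj ≠ 0)
    (heig : Transmission.IsEigenpair aR b c uj lamj)
    (muL muR : ℂ → ℂ) (hmuL : Transmission.IsSqrtBranch muL 1 lamj)
    (hmuR : Transmission.IsSqrtBranch muR aR lamj)
    (γ : ℕ → ℂ)
    (hγ : ∀ᶠ z in nhds lamj, HasSum (fun l : ℕ => γ l * (z - lamj) ^ l)
      (Transmission.matM aR b c (muL z) (muR z)).det)
    (ν : ℕ) (hν : ∀ l < ν, γ l = 0) (hν' : γ ν ≠ 0) :
    -- the ascent and the algebraic multiplicity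
    Transmission.IsAscent (Transmission.nullSpace aR b c lamj) ν ∧
    Module.finrank ℂ (Transmission.nullSpace aR b c lamj ν) = ν ∧
    -- the same for the solution operator of the form shifted by `Λ`
    (∀ (Lam : ℝ) (K : Module.End ℂ Transmission.V),
      Transmission.IsSolutionOperator aR b c Lam K →
      lamj + Lam ≠ 0 ∧
      Transmission.IsAscent (Transmission.kerPow K (lamj + Lam)⁻¹) ν ∧
      ∀ k, Transmission.kerPow K (lamj + Lam)⁻¹ k = Transmission.nullSpace aR b c lamj k) ∧
    -- the eigenfunction extends analytically in the spectral parameter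
    (∃ (A : ℂ → Fin 2 → ℂ) (i : Fin 2), Transmission.Extends aR b c muL muR lamj uj A ∧
      Transmission.SolvesRow aR b c muL muR lamj A i) ∧
    (∀ (A : ℂ → Fin 2 → ℂ) (i : Fin 2), Transmission.Extends aR b c muL muR lamj uj A →
      Transmission.SolvesRow aR b c muL muR lamj A i →
      Transmission.SolvesToOrder aR b c muL muR lamj A ν) ∧
    -- the derivatives of every such extension form chains of generalized eigenfunctions
    ∀ A : ℂ → Fin 2 → ℂ, Transmission.Extends aR b c muL muR lamj uj A →
      Transmission.SolvesToOrder aR b c muL muR lamj A ν →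
      ∃ w : ℕ → Transmission.V,
        (∀ l ∈ Set.Icc 1 ν, ∀ x : unitInterval, (w l).1 x =
          iteratedDeriv (l - 1)
            (fun z => Transmission.ansatz aR b c (muL z) (muR z) (A z) x) lamj) ∧
        Submodule.span ℂ (w '' Set.Icc 1 ν) = Transmission.nullSpace aR b c lamj ν ∧
        ∀ l ∈ Set.Icc 1 ν, w l ∈ Transmission.nullSpace aR b c lamj l ∧
          ∀ k < l, w l ∉ Transmission.nullSpace aR b c lamj k := by
  have haR0 : aR ≠ 0 := by
    rintro rfl
    simp at haR
  have hu : Transmission.opA aR b c uj = Transmission.opI (lamj • uj) := by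
    refine LinearMap.ext fun v => ?_
    rw [heig.2 v, map_smul]
    rfl
  have hM := Transmission.analyticAt_matM (aR := aR) (b := b) (c := c) hmuL.1 hmuR.1
  have hder := Transmission.iteratedDeriv_of_hasSum (Transmission.analyticAt_det hM) hγ
  have hdet : ∀ l < ν, iteratedDeriv l
      (fun z => (Transmission.matM aR b c (muL z) (muR z)).det) lamj = 0 := fun l hl => by
    rw [hder, hν l hl, mul_zero]
  have hdet' : iteratedDeriv ν
      (fun z => (Transmission.matM aR b c (muL z) (muR z)).det) lamj ≠ 0 := by
    rw [hder]
    exact mul_ne_zero (by exact_mod_cast ν.factorial_ne_zero) hν'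
  obtain ⟨A₀, i₀, hext, hrow⟩ :=
    Transmission.exists_extends_solvesRow haR0 hb hlamj hmuL hmuR hu
  have hsolves : ∀ (A : ℂ → Fin 2 → ℂ) (i : Fin 2), Transmission.Extends aR b c muL muR lamj uj A →
      Transmission.SolvesRow aR b c muL muR lamj A i →
      Transmission.SolvesToOrder aR b c muL muR lamj A ν := fun A i hA hi =>
    Transmission.isBigO_mulVec hM (Transmission.analyticAt_apply hA)
      ((Transmission.isBigO_pow_iff (Transmission.analyticAt_det hM)).2 hdet) hi.1 hi.2
  -- If ν = 0, the determinant is nonzero at λ_j, so the kernel of M(λ_j) is trivial and the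
  -- eigenfunction vanishes.
  have hpos : 0 < ν := by
    rw [Nat.pos_iff_ne_zero]
    rintro rfl
    have hmL : muL lamj ^ 2 = lamj := by simpa using Transmission.sqrtBranch_sq hmuL
    obtain ⟨B, hB, hB0⟩ := Transmission.exists_kernel_of_eigen haR0 hb hlamj hmL
      (Transmission.sqrtBranch_sq hmuR) hu
    rw [iteratedDeriv_zero] at hdet'
    have := Matrix.eq_zero_of_mulVec_eq_zero hdet' hB0
    refine heig.1 (Transmission.V_ext fun x => ?_)
    rw [hB x, this, Transmission.ansatz]
    simp
  have hchain : ∀ A : ℂ → Fin 2 → ℂ, Transmission.Extends aR b c muL muR lamj uj A →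
      Transmission.SolvesToOrder aR b c muL muR lamj A ν → _ := fun A hA hAν =>
    Transmission.exists_isMaximalChain haR0 hb hlamj hmuL hmuR heig.1 hu hdet hdet' hpos hA hAν
  obtain ⟨y, hy, -⟩ := hchain A₀ hext (hsolves A₀ i₀ hext hrow)
  refine ⟨hy.isAscent, hy.finrank_nullSpace le_rfl, fun Lam K hK => ?_, ⟨A₀, i₀, hext, hrow⟩,
    hsolves, fun A hA hAν => ?_⟩
  · have hne := hK.add_ne_zero heig.1 hu
    have hker := hK.kerPow_eq hne
    refine ⟨hne, ?_, hker⟩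
    rw [show Transmission.kerPow K (lamj + Lam)⁻¹ = Transmission.nullSpace aR b c lamj from
      funext hker]
    exact hy.isAscent
  · obtain ⟨y, hy, hval⟩ := hchain A hA hAν
    -- The functions w are numbered from 1 and the chain from 0.
    refine ⟨fun l => y (l - 1), fun l hl => hval (l - 1) (by have := hl.1; have := hl.2; omega),
      ?_, fun l hl => ?_⟩
    · rw [hy.nullSpace_eq_span le_rfl]
      congr 1
      ext v
      constructor
      · rintro ⟨l, hl, rfl⟩
        exact ⟨l - 1, by have := hl.1; have := hl.2; simp only [Set.mem_Iio]; omega, rfl⟩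
      · rintro ⟨n, hn, rfl⟩
        exact ⟨n + 1, ⟨by omega, hn⟩, rfl⟩
    · obtain ⟨n, rfl⟩ : ∃ n, l = n + 1 := ⟨l - 1, by have := hl.1; omega⟩
      have hn : n < ν := hl.2
      exact ⟨hy.mem hn, fun k hk hmem =>
        hy.notMem hn (Transmission.nullSpace_mono (Nat.le_of_lt_succ hk) hmem)⟩
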